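/- **Random MERA.** Let $D_0=1$ and let $D_k, D'_k$ ($k\ge 1$) be positive integers with $D_{k-1}\le (D'_k)^2$ and $D'_k\le D_k$ for all levels $k$ considered. At level $k$ there are $2^k$ sites, labelled modulo $2^k$. Start with the unit vector $\psi_0$ of one site of dimension $D_0=1$. The layer $V_k$ is a product of isometries, one for each of the $2^{k-1}$ sites $s$, mapping site $s$ (dimension $D_{k-1}$) to the two sites $2s,2s+1$ (dimension $D'_k$ each). The layer $W_k$ is a product of isometries, one for each pair of sites $2s+1,2s+2$ modulo $2^k$, mapping the pair (dimension $D'_k$ per site) to the same pair (dimension $D_k$ per site). All these isometries are independent and Haar distributed, and $E$ denotes the average over all of them. Put $\psi(k)=W_kV_k\cdots W_1V_1\psi_0$, $\phi(k)=V_kW_{k-1}V_{k-1}\cdots W_1V_1\psi_0$, $\sigma(k)=|\psi(k)\rangle\langle\psi(k)|$ and $\tau(k)=|\phi(k)\rangle\langle\phi(k)|$. For an interval $[i,j]$ of sites (modulo $2^k$) let $S(\rho_{[i,j]})$ be the von Neumann entropy (natural logarithm) of the reduced density matrix of $\rho$ on the interval. **Reduction sequences.** A reduction sequence $Q$ for an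 interval $[i,j]$ of $\sigma(k)$ or $\tau(k)$ applies the following steps until the interval $[i,j]$ satisfies $i=j+1$ modulo the number of sites of its row (it is empty, or it consists of all sites), and then stops. * An interval $[i,j]$ of $\sigma(k)$ is replaced by an interval $[m,n]$ of $\tau(k)$ with $|m-i|\le1$, $|n-j|\le 1$, $m$ odd, $n$ even. The cost is $\log(D_k)\,(|m-i|+|n-j|)$. * An interval $[i,j]$ of $\tau(k)$ is replaced by the interval $[m/2,(n-1)/2]$ of $\sigma(k-1)$, where $|m-i|\le1$, $|n-j|\le 1$, $m$ even, $n$ odd. The cost is $\log(D'_k)\,(|m-i|+|n-j|)$. Let $S(Q)$ be the sum of the costs of the steps of $Q$, and let $h(Q)$ be the number of its steps. **Lemma.** There is a universal constant $C>0$ such that, for all such dimensions, all levels $k$, and every interval $[i,j]$ of $\rho=\sigma(k)$ ($k\ge0$) or of $\rho=\tau(k)$ ($k\ge1$), the minima below over all reduction sequences $Q$ for $[i,j]$ exist, and $$S(\rho_{[i,j]})\le \min_Q S(Q)\quad\text{for every choice of the isometries,}$$ $$E\big[S(\rho_{[i,j]})\big]\ \ge\ \min_Q\big(S(Q)-C\,h(Q)\big).$$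 -/

import Mathlib

open MeasureTheory

namespace RandomMERA

noncomputable section

/-! ## Haar-random isometries -/

/-- Isometries `ℂⁿ → ℂᵐ`, as matrices `W` with `Wᴴ W = 1`. -/
abbrev IsometryMatrix (m n : Type) [Fintype m] [DecidableEq n] : Type :=
  {W : Matrix m n ℂ // W.conjTranspose * W = 1}

instance (m n : Type) [Fintype m] [DecidableEq n] : MeasurableSpace (IsometryMatrix m n) :=
  borel _

instance (m n : Type) [Fintype m] [DecidableEq n] : BorelSpace (IsometryMatrix m n) := ⟨rfl⟩

instance (m : Type) [Fintype m] [DecidableEq m] : MeasurableSpace (Matrix.unitaryGroup m ℂ) :=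
  borel _

instance (m : Type) [Fintype m] [DecidableEq m] : BorelSpace (Matrix.unitaryGroup m ℂ) := ⟨rfl⟩

instance (m : Type) [Fintype m] [DecidableEq m] : CompactSpace (Matrix.unitaryGroup m ℂ) := by
  have hK : IsCompact (Set.pi Set.univ fun _ : m => Set.pi Set.univ fun _ : m =>
      Metric.closedBall (0 : ℂ) 1) :=
    isCompact_univ_pi fun _ => isCompact_univ_pi fun _ => isCompact_closedBall 0 1
  have hc : IsClosed {U : Matrix m m ℂ | U ∈ Matrix.unitaryGroup m ℂ} := by
    have h : {U : Matrix m m ℂ | U ∈ Matrix.unitaryGroup m ℂ}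
        = {U : Matrix m m ℂ | U * star U = 1} := by
      ext U
      exact Matrix.mem_unitaryGroup_iff
    rw [h]
    exact isClosed_eq (by fun_prop) continuous_const
  have hsub : {U : Matrix m m ℂ | U ∈ Matrix.unitaryGroup m ℂ} ⊆
      Set.pi Set.univ fun _ : m => Set.pi Set.univ fun _ : m => Metric.closedBall (0 : ℂ) 1 := by
    intro U hU i _ j _
    simpa using entry_norm_bound_of_unitary hU i j
  exact isCompact_iff_compactSpace.mp (IsCompact.of_isClosed_subset hK hc hsub)

/-- The unitary `U` acting on the isometry `W` from the left. -/
def unitaryMul {m n : Type} [Fintype m] [DecidableEq m] [DecidableEq n]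
    (U : Matrix.unitaryGroup m ℂ) (W : IsometryMatrix m n) : IsometryMatrix m n :=
  ⟨U.1 * W.1, by
    have hU : U.1.conjTranspose * U.1 = 1 := Matrix.mem_unitaryGroup_iff'.mp U.2
    rw [Matrix.conjTranspose_mul, Matrix.mul_assoc, ← Matrix.mul_assoc _ U.1 W.1, hU,
      Matrix.one_mul, W.2]⟩

open Classical in
/-- The Haar uniform distribution on isometries `ℂⁿ → ℂᵐ`: the law of `U W₀`, where `U` is a
Haar-distributed unitary of `ℂᵐ` (total mass one) and `W₀` is any fixed isometry. The law does not
depend on `W₀`, since any two isometries differ by a unitary. If there is no isometry at all, the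
measure is zero. -/
def haarIsometry (m n : Type) [Fintype m] [DecidableEq m] [DecidableEq n] :
    Measure (IsometryMatrix m n) :=
  if h : Nonempty (IsometryMatrix m n) then
    (Measure.haarMeasure (⊤ : TopologicalSpace.PositiveCompacts (Matrix.unitaryGroup m ℂ))).map
      fun U => unitaryMul U h.some
  else 0

instance (m n : Type) [Fintype m] [DecidableEq m] [DecidableEq n] :
    IsFiniteMeasure (haarIsometry m n) := by
  unfold haarIsometry
  split_ifs <;> infer_instance

/-- If there is an isometry at all, the Haar distribution has total mass one. -/
theorem isProbabilityMeasure_haarIsometry (m n : Type) [Fintype m] [DecidableEq m] [DecidableEq n]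
    [h : Nonempty (IsometryMatrix m n)] : IsProbabilityMeasure (haarIsometry m n) := by
  have hp : IsProbabilityMeasure
      (Measure.haarMeasure (⊤ : TopologicalSpace.PositiveCompacts (Matrix.unitaryGroup m ℂ))) :=
    ⟨by simpa using
      Measure.haarMeasure_self (K₀ := (⊤ : TopologicalSpace.PositiveCompacts
        (Matrix.unitaryGroup m ℂ)))⟩
  unfold haarIsometry
  rw [dif_pos h]
  refine Measure.isProbabilityMeasure_map (Continuous.aemeasurable ?_)
  unfold unitaryMul
  fun_prop

/-! ## The MERA network

`D k` is the dimension of a site after the layer `W_k` (and `D 0` that of the single top site),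
`D' k` is the dimension of a site after the layer `V_k`. At level `k` the sites are `ZMod (2 ^ k)`.
-/

/-- The layer `V_{k+1}`: one isometry for each of the `2 ^ k` sites, from the site to two sites. -/
abbrev VLayer (D D' : ℕ → ℕ) (k : ℕ) : Type :=
  ZMod (2 ^ k) → IsometryMatrix (Fin (D' (k + 1)) × Fin (D' (k + 1))) (Fin (D k))

/-- The layer `W_{k+1}`: one isometry for each of the `2 ^ k` pairs of neighboring sites, from the
pair to the same pair with larger site dimension. -/
abbrev WLayer (D D' : ℕ → ℕ) (k : ℕ) : Type :=
  ZMod (2 ^ k) → IsometryMatrix (Fin (D (k + 1)) × Fin (D (k + 1)))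
    (Fin (D' (k + 1)) × Fin (D' (k + 1)))

/-- All the isometries `V_1, W_1, …, V_L, W_L` of a MERA with `L` levels. -/
def Circuit (D D' : ℕ → ℕ) : ℕ → Type
  | 0 => Unit
  | k + 1 => Circuit D D' k × VLayer D D' k × WLayer D D' k

instance instMeasurableSpaceCircuit (D D' : ℕ → ℕ) : (L : ℕ) → MeasurableSpace (Circuit D D' L)
  | 0 => inferInstanceAs (MeasurableSpace Unit)
  | k + 1 =>
    letI := instMeasurableSpaceCircuit D D' k
    inferInstanceAs (MeasurableSpace (Circuit D D' k × VLayer D D' k × WLayer D D' k))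

/-- The random MERA: all isometries independent and Haar distributed. -/
def circuitMeasure (D D' : ℕ → ℕ) : (L : ℕ) → Measure (Circuit D D' L)
  | 0 => (Measure.dirac () : Measure Unit)
  | k + 1 => (circuitMeasure D D' k).prod
      ((Measure.pi fun _ => haarIsometry _ _ : Measure (VLayer D D' k)).prod
        (Measure.pi fun _ => haarIsometry _ _ : Measure (WLayer D D' k)))

/-- Vectors of a system of `2 ^ k` sites with a `d`-dimensional Hilbert space on each site, through
their amplitudes in the product basis. -/
abbrev StateVector (k d : ℕ) : Type := (ZMod (2 ^ k) → Fin d) → ℂ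

/-- `V_{k+1}` applied to a vector: site `s` is mapped to the pair of sites `2s, 2s+1`. -/
def applyV {D D' : ℕ → ℕ} {k : ℕ} (V : VLayer D D' k) (v : StateVector k (D k)) :
    StateVector (k + 1) (D' (k + 1)) := fun y =>
  ∑ x : ZMod (2 ^ k) → Fin (D k),
    (∏ s : ZMod (2 ^ k),
      (V s).1 (y ((2 * s.val : ℕ) : ZMod (2 ^ (k + 1))),
        y ((2 * s.val + 1 : ℕ) : ZMod (2 ^ (k + 1)))) (x s)) * v x

/-- `W_{k+1}` applied to a vector: the `s`-th isometry acts on the pair of sites `2s+1, 2s+2`,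
modulo `2 ^ (k + 1)`. -/
def applyW {D D' : ℕ → ℕ} {k : ℕ} (W : WLayer D D' k) (v : StateVector (k + 1) (D' (k + 1))) :
    StateVector (k + 1) (D (k + 1)) := fun z =>
  ∑ y : ZMod (2 ^ (k + 1)) → Fin (D' (k + 1)),
    (∏ s : ZMod (2 ^ k),
      (W s).1
        (z ((2 * s.val + 1 : ℕ) : ZMod (2 ^ (k + 1))),
          z ((2 * s.val + 2 : ℕ) : ZMod (2 ^ (k + 1))))
        (y ((2 * s.val + 1 : ℕ) : ZMod (2 ^ (k + 1))),
          y ((2 * s.val + 2 : ℕ) : ZMod (2 ^ (k + 1))))) * v y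

/-- `ψ(L) = W_L V_L ⋯ W_1 V_1 ψ₀`, the MERA state with `L` levels. The initial state `ψ₀` is the
unit vector of a single site; its dimension `D 0` is one in all uses. -/
def psi {D D' : ℕ → ℕ} : (L : ℕ) → Circuit D D' L → StateVector L (D L)
  | 0, _ => fun _ => 1
  | k + 1, c => applyW c.2.2 (applyV c.2.1 (psi k c.1))

/-- `φ(L) = V_L W_{L-1} V_{L-1} ⋯ W_1 V_1 ψ₀` for `L = k + 1`, the state before the last layer
`W_L`. -/
def phi {D D' : ℕ → ℕ} (k : ℕ) (c : Circuit D D' (k + 1)) : StateVector (k + 1) (D' (k + 1)) :=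
  applyV c.2.1 (psi k c.1)

/-! ## Entropy of an interval -/

/-- The von Neumann entropy `-tr (ρ log ρ)`, with the natural logarithm. -/
def vonNeumannEntropy {n : Type} [Fintype n] [DecidableEq n] {ρ : Matrix n n ℂ}
    (hρ : ρ.IsHermitian) : ℝ :=
  ∑ a, Real.negMulLog (hρ.eigenvalues a)

/-- The density matrix `|v⟩⟨v|`. -/
def density {ι : Type} (v : ι → ℂ) : Matrix ι ι ℂ := Matrix.vecMulVec v (star v)

/-- The reduced density matrix on the set of sites `A`: the partial trace over all other sites. -/
def reduced {ι α : Type} [Fintype ι] [DecidableEq ι] [Fintype α] (A : Finset ι)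
    (ρ : Matrix (ι → α) (ι → α) ℂ) : Matrix ({s // s ∈ A} → α) ({s // s ∈ A} → α) ℂ := fun x x' =>
  ∑ z : {s // s ∉ A} → α,
    ρ ((Equiv.piEquivPiSubtypeProd (· ∈ A) fun _ => α).symm (x, z))
      ((Equiv.piEquivPiSubtypeProd (· ∈ A) fun _ => α).symm (x', z))

theorem isHermitian_reduced_density {ι α : Type} [Fintype ι] [DecidableEq ι] [Fintype α]
    (A : Finset ι) (v : (ι → α) → ℂ) : (reduced A (density v)).IsHermitian := by
  ext x x'
  simp [reduced, density, Matrix.vecMulVec_apply, Matrix.conjTranspose_apply, mul_comm]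

/-- The sites `i, i+1, …, j` modulo `2 ^ k`. -/
def intervalSites (k : ℕ) (i j : ℤ) : Finset (ZMod (2 ^ k)) :=
  (Finset.Icc i j).image fun t : ℤ => (t : ZMod (2 ^ k))

/-- The von Neumann entropy of the interval `[i, j]` in the pure state `v`. -/
def intervalEntropy {k d : ℕ} (v : StateVector k d) (i j : ℤ) : ℝ :=
  vonNeumannEntropy (isHermitian_reduced_density (intervalSites k i j) v)

/-! ## Reduction sequences -/

/-- The two kinds of rows of the network: `sigma` is the row after a layer `W_k`, and `tau` is the
row after a layer `V_k`. -/
inductive Row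
  | sigma
  | tau

/-- A reduction sequence for the interval `[i, j]` of the row `σ(k)` or `τ(k)`: the interval is
reduced step by step until it is empty, which for intervals of sites modulo `2 ^ k` means
`i = j + 1` modulo `2 ^ k` (so that an interval of all sites also counts as empty; as the state is
pure, both have zero entropy). A step replaces `i, j` by `m, n` with `|m - i| ≤ 1`, `|n - j| ≤ 1`,
where `m` is odd and `n` even when going from `σ(k)` to `τ(k)`, and where `m` is even and `n` odd
when going from `τ(k)` to `σ(k-1)`; in the second case, the new interval is
`[m / 2, (n - 1) / 2]`. The endpoints are integer representatives of sites. -/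
inductive ReductionSequence : Row → ℕ → ℤ → ℤ → Type
  | nil {r : Row} {k : ℕ} {i j : ℤ} (h : ((2 : ℤ) ^ k) ∣ j + 1 - i) : ReductionSequence r k i j
  | sigmaStep {k : ℕ} {i j : ℤ} (h : ¬ ((2 : ℤ) ^ k) ∣ j + 1 - i) (m n : ℤ) (hm : Odd m)
      (hn : Even n) (hmi : |m - i| ≤ 1) (hnj : |n - j| ≤ 1)
      (rest : ReductionSequence Row.tau k m n) : ReductionSequence Row.sigma k i j
  | tauStep {k : ℕ} {i j : ℤ} (h : ¬ ((2 : ℤ) ^ (k + 1)) ∣ j + 1 - i) (m n : ℤ) (hm : Even m)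
      (hn : Odd n) (hmi : |m - i| ≤ 1) (hnj : |n - j| ≤ 1)
      (rest : ReductionSequence Row.sigma k (m / 2) ((n - 1) / 2)) :
      ReductionSequence Row.tau (k + 1) i j

namespace ReductionSequence

/-- The upper bound `S(Q)` to the entropy: the sum of `log (D k) (|m - i| + |n - j|)` over the steps
from `σ(k)` to `τ(k)` and of `log (D' k) (|m - i| + |n - j|)` over the steps from `τ(k)` to
`σ(k-1)`. -/
def cost (D D' : ℕ → ℕ) :
    {r : Row} → {k : ℕ} → {i j : ℤ} → ReductionSequence r k i j → ℝ
  | _, _, _, _, nil _ => 0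
  | _, k, i, j, sigmaStep _ m n _ _ _ _ rest =>
      Real.log (D k) * ((|m - i| + |n - j| : ℤ) : ℝ) + rest.cost D D'
  | _, k + 1, i, j, tauStep _ m n _ _ _ _ rest =>
      Real.log (D' (k + 1)) * ((|m - i| + |n - j| : ℤ) : ℝ) + rest.cost D D'

/-- The height `h(Q)`: the number of steps. -/
def height : {r : Row} → {k : ℕ} → {i j : ℤ} → ReductionSequence r k i j → ℕ
  | _, _, _, _, nil _ => 0
  | _, _, _, _, sigmaStep _ _ _ _ _ _ _ rest => rest.height + 1
  | _, _, _, _, tauStep _ _ _ _ _ _ _ rest => rest.height + 1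

end ReductionSequence

end

end RandomMERA

/-! The upper bound is deterministic. An isometry acting inside a set of sites, or inside its
complement, does not change the entropy of that set (`setEntropy_gate`). Adding or removing one site
of dimension `d` changes the entropy by at most `log d` (`setEntropy_insert_le`,
`setEntropy_le_insert`). A reduction step moves the endpoints until the interval is a union of gate
blocks, pays for the moved sites, and strips the layer.

The lower bound goes through the purity, the expectation of the swap of `A` between two copies of
the state. By unitary invariance, the second moments of a Haar isometry are combinations of the two
pairings of row indices (`exists_haarMoment_eq`). Averaging a gate with output sites of dimension
`d` therefore turns a swap of both outputs into the swap of the input, no swap into the identity,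
and a swap of one output into `d / (d ^ 2 + 1) ≤ 1 / d` times the sum of both
(`sum_haarMoment_swaps`).

An interval cuts at most the gates at its two ends. Hence its average purity is a sum over at most
four intervals of the previous row, one for each choice of keeping or dropping the cut blocks, with
a factor `1 / d` for each cut (`sum_pairWeight_interval_le`). These choices are exactly the endpoint
moves of a reduction step, and `1 / d` is the exponential of minus their cost. By induction the
average purity is at most `exp (-min (S(Q) - h(Q) log 4))`, so `C = log 4` works. A tangent-line
form of `S ≥ -log purity` (`le_specEntropy_of_trace_sq`) is affine in the purity and carries the
bound over to the average entropy. -/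

namespace RandomMERA

open Matrix Finset
open scoped ComplexOrder

/-! ## Spectral entropy -/

section Entropy

variable {n m : Type} [Fintype n] [DecidableEq n] [Fintype m] [DecidableEq m]

/-- The entropy of the spectrum of a matrix, through the roots of its characteristic polynomial. -/
noncomputable def specEntropy (M : Matrix n n ℂ) : ℝ :=
  (M.charpoly.roots.map fun z => Real.negMulLog z.re).sum

theorem vonNeumannEntropy_eq_specEntropy {ρ : Matrix n n ℂ} (hρ : ρ.IsHermitian) :
    vonNeumannEntropy hρ = specEntropy ρ := by
  rw [vonNeumannEntropy, specEntropy, hρ.roots_charpoly_eq_eigenvalues, Multiset.map_map]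
  rfl

/-- The characteristic polynomials of `A * B` and `B * A` agree up to powers of `X`, and the extra
zero roots contribute `negMulLog 0 = 0`. Invariance under isometries and the equality of
complementary entropies both rest on this. -/
theorem specEntropy_mul_comm (A : Matrix m n ℂ) (B : Matrix n m ℂ) :
    specEntropy (A * B) = specEntropy (B * A) := by
  have h := congrArg Polynomial.roots (Matrix.charpoly_mul_comm' A B)
  rw [Polynomial.roots_mul, Polynomial.roots_mul] at h
  · have := congrArg (fun s : Multiset ℂ => (s.map fun z => Real.negMulLog z.re).sum) h
    simpa [specEntropy, Multiset.map_nsmul, Multiset.sum_nsmul] using this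
  · exact mul_ne_zero (pow_ne_zero _ Polynomial.X_ne_zero) (Matrix.charpoly_monic _).ne_zero
  · exact mul_ne_zero (pow_ne_zero _ Polynomial.X_ne_zero) (Matrix.charpoly_monic _).ne_zero

theorem specEntropy_submatrix (e : n ≃ m) (M : Matrix m m ℂ) :
    specEntropy (M.submatrix e e) = specEntropy M := by
  have : M.submatrix e e = Matrix.reindex e.symm e.symm M := by simp
  rw [specEntropy, this, Matrix.charpoly_reindex, specEntropy]

theorem specEntropy_transpose (M : Matrix n n ℂ) : specEntropy Mᵀ = specEntropy M := by
  rw [specEntropy, Matrix.charpoly_transpose, specEntropy]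

theorem specEntropy_conj_isometry (K : Matrix m n ℂ) (hK : Kᴴ * K = 1) (M : Matrix n n ℂ) :
    specEntropy (K * M * Kᴴ) = specEntropy M := by
  rw [specEntropy_mul_comm, ← Matrix.mul_assoc, hK, Matrix.one_mul]

/-- The spectral theorem in the form of a plain matrix product. -/
theorem exists_unitary_diagonal {ρ : Matrix n n ℂ} (hρ : ρ.IsHermitian) :
    ∃ U : Matrix n n ℂ, Uᴴ * U = 1 ∧ U * Uᴴ = 1 ∧
      ρ = U * diagonal (fun i => (hρ.eigenvalues i : ℂ)) * Uᴴ := by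
  refine ⟨hρ.eigenvectorUnitary, ?_, ?_, ?_⟩
  · exact Matrix.mem_unitaryGroup_iff'.mp hρ.eigenvectorUnitary.2
  · exact Matrix.mem_unitaryGroup_iff.mp hρ.eigenvectorUnitary.2
  · exact hρ.spectral_theorem

theorem trace_pow_eq_sum_eigenvalues {ρ : Matrix n n ℂ} (hρ : ρ.IsHermitian) (k : ℕ) :
    (ρ ^ k).trace = ((∑ i, hρ.eigenvalues i ^ k : ℝ) : ℂ) := by
  obtain ⟨U, h1, h2, h⟩ := exists_unitary_diagonal hρ
  have hp : ρ ^ k = U * diagonal (fun i => (hρ.eigenvalues i : ℂ) ^ k) * Uᴴ := by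
    induction k with
    | zero => simp [h2]
    | succ k ih =>
      rw [pow_succ, ih]
      refine (congrArg (fun M => U * diagonal (fun i => (hρ.eigenvalues i : ℂ) ^ k) * Uᴴ * M)
        h).trans ?_
      calc _ = U * diagonal (fun i => (hρ.eigenvalues i : ℂ) ^ k) * (Uᴴ * U)
              * diagonal (fun i => (hρ.eigenvalues i : ℂ)) * Uᴴ := by
            simp only [Matrix.mul_assoc]
        _ = _ := by
            rw [h1, Matrix.mul_one, Matrix.mul_assoc U, Matrix.diagonal_mul_diagonal]
            simp only [pow_succ]
  rw [hp, Matrix.trace_mul_comm, ← Matrix.mul_assoc, h1, Matrix.one_mul, Matrix.trace_diagonal]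
  push_cast
  rfl

/-- The entropy is at most the entropy of the diagonal. -/
theorem specEntropy_le_diag {ρ : Matrix n n ℂ} (hρ : ρ.PosSemidef) :
    specEntropy ρ ≤ ∑ i, Real.negMulLog (ρ i i).re := by
  obtain ⟨U, h1, h2, h⟩ := exists_unitary_diagonal hρ.1
  -- The matrix `|U i j| ^ 2` is doubly stochastic. Its row sums make each diagonal entry of `ρ` a
  -- convex combination of eigenvalues, to which concavity applies; its column sums restore the full
  -- weight of each eigenvalue.
  have hrow : ∀ i, ∑ j, Complex.normSq (U i j) = 1 := by
    intro i
    have := congrFun (congrFun h2 i) i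
    simp only [Matrix.mul_apply, Matrix.conjTranspose_apply, Matrix.one_apply_eq, RCLike.star_def,
      Complex.mul_conj] at this
    exact_mod_cast this
  have hcol : ∀ j, ∑ i, Complex.normSq (U i j) = 1 := by
    intro j
    have := congrFun (congrFun h1 j) j
    simp only [Matrix.mul_apply, Matrix.conjTranspose_apply, Matrix.one_apply_eq, RCLike.star_def,
      mul_comm ((starRingEnd ℂ) _), Complex.mul_conj] at this
    exact_mod_cast this
  have hd : ∀ i, (ρ i i).re = ∑ j, Complex.normSq (U i j) * hρ.1.eigenvalues j := by
    intro i
    refine (congrArg (fun M : Matrix n n ℂ => (M i i).re) h).trans ?_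
    rw [Matrix.mul_apply, Complex.re_sum]
    refine Finset.sum_congr rfl fun j _ => ?_
    rw [Matrix.mul_diagonal, Matrix.conjTranspose_apply, mul_right_comm]
    simp only [RCLike.star_def]
    rw [Complex.mul_conj, ← Complex.ofReal_mul, Complex.ofReal_re]
  calc specEntropy ρ = ∑ j, Real.negMulLog (hρ.1.eigenvalues j) := by
        rw [← vonNeumannEntropy_eq_specEntropy hρ.1, vonNeumannEntropy]
    _ = ∑ j, ∑ i, Complex.normSq (U i j) * Real.negMulLog (hρ.1.eigenvalues j) := by
        simp only [← Finset.sum_mul, hcol, one_mul]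
    _ = ∑ i, ∑ j, Complex.normSq (U i j) * Real.negMulLog (hρ.1.eigenvalues j) :=
        Finset.sum_comm
    _ ≤ _ := by
        refine Finset.sum_le_sum fun i _ => ?_
        rw [hd]
        simpa only [smul_eq_mul] using Real.concaveOn_negMulLog.le_map_sum
          (t := Finset.univ) (w := fun j => Complex.normSq (U i j)) (p := hρ.1.eigenvalues)
          (fun j _ => Complex.normSq_nonneg _) (hrow i) (fun j _ => hρ.eigenvalues_nonneg j)

/-- Jensen with uniform weights. The total mass is left free because the bound is applied to each
block of a joint distribution. -/
theorem sum_negMulLog_le {β : Type} [Fintype β] [Nonempty β] (p : β → ℝ) (hp : ∀ b, 0 ≤ p b) :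
    ∑ b, Real.negMulLog (p b) ≤
      Real.negMulLog (∑ b, p b) + (∑ b, p b) * Real.log (Fintype.card β) := by
  have hc : (0 : ℝ) < Fintype.card β := by exact_mod_cast Fintype.card_pos
  have h := Real.concaveOn_negMulLog.le_map_sum (t := Finset.univ)
    (w := fun _ : β => (Fintype.card β : ℝ)⁻¹) (p := p) (fun _ _ => by positivity)
    (by simp [hc.ne']) (fun b _ => hp b)
  simp only [smul_eq_mul, ← Finset.mul_sum] at h
  rw [Real.negMulLog_mul, Real.negMulLog, Real.log_inv] at h
  have h2 := mul_le_mul_of_nonneg_left h hc.le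
  rw [← mul_assoc, mul_inv_cancel₀ hc.ne', one_mul] at h2
  refine h2.trans (le_of_eq ?_)
  field_simp
  ring

/-- Subadditivity, with the maximal entropy for the second factor. -/
theorem specEntropy_le_partialTrace [Nonempty m] {ρ : Matrix (n × m) (n × m) ℂ}
    (hρ : ρ.PosSemidef) (htr : ρ.trace = 1) :
    specEntropy ρ ≤ specEntropy (Matrix.of fun i j => ∑ b, ρ (i, b) (j, b))
      + Real.log (Fintype.card m) := by
  set σ : Matrix n n ℂ := Matrix.of fun i j => ∑ b, ρ (i, b) (j, b) with hσ
  have hσH : σ.IsHermitian := by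
    ext i j
    simp only [hσ, Matrix.conjTranspose_apply, Matrix.of_apply, star_sum]
    exact Finset.sum_congr rfl fun b _ => hρ.1.apply _ _
  obtain ⟨U, h1, h2, h⟩ := exists_unitary_diagonal hσH
  have hUσ : Uᴴ * σ * U = diagonal (fun i => (hσH.eigenvalues i : ℂ)) := by
    refine (congrArg (fun M => Uᴴ * M * U) h).trans ?_
    calc _ = (Uᴴ * U) * diagonal (fun i => (hσH.eigenvalues i : ℂ)) * (Uᴴ * U) := by
          simp only [Matrix.mul_assoc]
      _ = _ := by rw [h1, Matrix.one_mul, Matrix.mul_one]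
  -- Rotating the first factor to the eigenbasis of the marginal `σ` makes the diagonal of the
  -- rotated `ρ` a joint distribution whose first marginal is the spectrum of `σ`. The claim then
  -- follows from the classical inequality for that diagonal.
  set K : Matrix (n × m) (n × m) ℂ := Matrix.kroneckerMap (· * ·) Uᴴ (1 : Matrix m m ℂ) with hK
  have hKK : Kᴴ * K = 1 := by
    rw [hK, Matrix.conjTranspose_kronecker, ← Matrix.mul_kronecker_mul]
    simp [h2]
  have hpsd : (K * ρ * Kᴴ).PosSemidef := hρ.mul_mul_conjTranspose_same K
  set p : n → m → ℝ := fun i b => ((K * ρ * Kᴴ) (i, b) (i, b)).re with hpdef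
  have hp : ∀ i b, 0 ≤ p i b := fun i b => (Complex.le_def.mp (hpsd.diag_nonneg (i := (i, b)))).1
  have hps : ∀ i, ∑ b, p i b = hσH.eigenvalues i := by
    intro i
    have e1 : ∑ b, (K * ρ * Kᴴ) (i, b) (i, b) = (Uᴴ * σ * U) i i := by
      simp only [Matrix.mul_apply, hK, Matrix.conjTranspose_apply, Matrix.kroneckerMap_apply,
        Fintype.sum_prod_type, hσ, Matrix.of_apply, Matrix.one_apply]
      simp only [mul_ite, mul_one, mul_zero, ite_mul, zero_mul, Finset.sum_ite_eq,
        Finset.mem_univ, if_true, apply_ite star, star_zero, star_star, Finset.sum_mul,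
        Finset.mul_sum]
      rw [Finset.sum_comm]
      refine Finset.sum_congr rfl fun j _ => ?_
      rw [Finset.sum_comm]
    have e2 := congrArg Complex.re e1
    rw [hUσ, Matrix.diagonal_apply_eq, Complex.ofReal_re, Complex.re_sum] at e2
    exact e2
  have hsum : ∑ i, hσH.eigenvalues i = 1 := by
    have := hσH.trace_eq_sum_eigenvalues
    have ht : σ.trace = 1 := by
      rw [← htr]
      simp [Matrix.trace, hσ, Fintype.sum_prod_type]
    rw [ht] at this
    simpa using (congrArg Complex.re this).symm
  calc specEntropy ρ = specEntropy (K * ρ * Kᴴ) := (specEntropy_conj_isometry K hKK ρ).symm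
    _ ≤ ∑ x : n × m, Real.negMulLog ((K * ρ * Kᴴ) x x).re := specEntropy_le_diag hpsd
    _ = ∑ i, ∑ b, Real.negMulLog (p i b) := Fintype.sum_prod_type _
    _ ≤ ∑ i, (Real.negMulLog (hσH.eigenvalues i)
          + hσH.eigenvalues i * Real.log (Fintype.card m)) := by
        refine Finset.sum_le_sum fun i _ => ?_
        rw [← hps i]
        exact sum_negMulLog_le (p i) (hp i)
    _ = _ := by
        rw [Finset.sum_add_distrib, ← Finset.sum_mul, hsum, one_mul,
          ← vonNeumannEntropy_eq_specEntropy hσH, vonNeumannEntropy]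

theorem sum_eigenvalues_of_trace_one {ρ : Matrix n n ℂ} (hρ : ρ.IsHermitian)
    (htr : ρ.trace = 1) : ∑ i, hρ.eigenvalues i = 1 := by
  have := hρ.trace_eq_sum_eigenvalues
  rw [htr] at this
  simpa using (congrArg Complex.re this).symm

theorem eigenvalues_le_one {ρ : Matrix n n ℂ} (hρ : ρ.PosSemidef) (htr : ρ.trace = 1) (i : n) :
    hρ.1.eigenvalues i ≤ 1 := by
  rw [← sum_eigenvalues_of_trace_one hρ.1 htr]
  exact Finset.single_le_sum (fun j _ => hρ.eigenvalues_nonneg j) (Finset.mem_univ i)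

theorem trace_sq_re_le_one {ρ : Matrix n n ℂ} (hρ : ρ.PosSemidef) (htr : ρ.trace = 1) :
    ((ρ ^ 2).trace).re ≤ 1 := by
  rw [trace_pow_eq_sum_eigenvalues hρ.1, Complex.ofReal_re,
    ← sum_eigenvalues_of_trace_one hρ.1 htr]
  refine Finset.sum_le_sum fun i _ => ?_
  have h0 := hρ.eigenvalues_nonneg i
  have h1 := eigenvalues_le_one hρ htr i
  nlinarith

/-- A linearized form of the bound of the von Neumann entropy by the second Rényi entropy. -/
theorem le_specEntropy_of_trace_sq {ρ : Matrix n n ℂ} (hρ : ρ.PosSemidef) (htr : ρ.trace = 1)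
    {t : ℝ} (ht : 0 < t) :
    -Real.log t + 1 - ((ρ ^ 2).trace).re / t ≤ specEntropy ρ := by
  rw [← vonNeumannEntropy_eq_specEntropy hρ.1, vonNeumannEntropy,
    trace_pow_eq_sum_eigenvalues hρ.1, Complex.ofReal_re]
  have hs := sum_eigenvalues_of_trace_one hρ.1 htr
  have : -Real.log t + 1 - (∑ i, hρ.1.eigenvalues i ^ 2) / t =
      ∑ i, (hρ.1.eigenvalues i * (-Real.log t + 1) - hρ.1.eigenvalues i ^ 2 / t) := by
    rw [Finset.sum_sub_distrib, ← Finset.sum_mul, hs, one_mul, Finset.sum_div]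
  rw [this]
  refine Finset.sum_le_sum fun i _ => ?_
  rcases (hρ.eigenvalues_nonneg i).eq_or_lt with h0 | h0
  · simp [← h0]
  -- `log x ≤ x - 1` at `x = λ / t`, multiplied by `λ`, is the required inequality for one
  -- eigenvalue.
  · have h := Real.log_le_sub_one_of_pos (div_pos h0 ht)
    rw [Real.log_div h0.ne' ht.ne'] at h
    have h' := mul_le_mul_of_nonneg_left h h0.le
    have e : hρ.1.eigenvalues i * (hρ.1.eigenvalues i / t - 1) =
      hρ.1.eigenvalues i ^ 2 / t - hρ.1.eigenvalues i := by ring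
    rw [Real.negMulLog]
    linarith

theorem specEntropy_nonneg {ρ : Matrix n n ℂ} (hρ : ρ.PosSemidef) (htr : ρ.trace = 1) :
    0 ≤ specEntropy ρ := by
  rw [← vonNeumannEntropy_eq_specEntropy hρ.1]
  exact Finset.sum_nonneg fun i _ =>
    Real.negMulLog_nonneg (hρ.eigenvalues_nonneg i) (eigenvalues_le_one hρ htr i)

/-- A crude bound from `-x log x ≤ 1 - x`, which suffices for integrability. -/
theorem specEntropy_le_card {ρ : Matrix n n ℂ} (hρ : ρ.PosSemidef) :
    specEntropy ρ ≤ Fintype.card n := by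
  rw [← vonNeumannEntropy_eq_specEntropy hρ.1, vonNeumannEntropy]
  calc _ ≤ ∑ _i : n, (1 : ℝ) := by
        refine Finset.sum_le_sum fun i _ => ?_
        rcases (hρ.eigenvalues_nonneg i).eq_or_lt with h0 | h0
        · simp [← h0]
        · have h := Real.one_sub_inv_le_log_of_pos h0
          have h' := mul_le_mul_of_nonneg_left h h0.le
          rw [mul_sub, mul_inv_cancel₀ h0.ne'] at h'
          rw [Real.negMulLog]
          linarith
    _ = _ := by simp

/-- The entropy is a pointwise limit of linear combinations of traces of powers. -/
theorem measurable_specEntropy {Ω : Type*} [MeasurableSpace Ω] {ρ : Ω → Matrix n n ℂ}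
    (hm : ∀ i j, Measurable fun c => ρ c i j) (hρ : ∀ c, (ρ c).PosSemidef)
    (htr : ∀ c, (ρ c).trace = 1) : Measurable fun c => specEntropy (ρ c) := by
  -- Weierstrass approximation on `[0, 1]`, which contains the spectrum. Polynomial spectral sums
  -- are traces of powers, so no measurability of individual eigenvalues is needed.
  have happ : ∀ N : ℕ, ∃ p : Polynomial ℝ, ∀ x ∈ Set.Icc (0 : ℝ) 1,
      |p.eval x - Real.negMulLog x| < 1 / ((N : ℝ) + 1) := fun N =>
    exists_polynomial_near_of_continuousOn 0 1 _ Real.continuous_negMulLog.continuousOn _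
      (by positivity)
  choose p hp using happ
  have hpow : ∀ k : ℕ, ∀ i j, Measurable fun c => (ρ c ^ k) i j := by
    intro k
    induction k with
    | zero => intro i j; simp only [pow_zero]; exact measurable_const
    | succ k ih =>
      intro i j
      simp only [pow_succ, Matrix.mul_apply]
      exact Finset.measurable_sum _ fun l _ => (ih i l).mul (hm l j)
  have hpe : ∀ N c, ∑ i, (p N).eval ((hρ c).1.eigenvalues i) =
      ∑ k ∈ Finset.range ((p N).natDegree + 1), (p N).coeff k * ((ρ c ^ k).trace).re := by
    intro N c
    simp only [trace_pow_eq_sum_eigenvalues (hρ c).1, Complex.ofReal_re, Finset.mul_sum,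
      Polynomial.eval_eq_sum_range]
    exact Finset.sum_comm
  refine measurable_of_tendsto_metrizable
    (f := fun (N : ℕ) c => ∑ k ∈ Finset.range ((p N).natDegree + 1),
      (p N).coeff k * ((ρ c ^ k).trace).re) (fun N => ?_) ?_
  · refine Finset.measurable_sum _ fun k _ => Measurable.const_mul ?_ _
    refine Complex.measurable_re.comp ?_
    simp only [Matrix.trace, Matrix.diag]
    exact Finset.measurable_sum _ fun i _ => hpow k i i
  · rw [tendsto_pi_nhds]
    intro c
    simp only [← hpe, ← vonNeumannEntropy_eq_specEntropy (hρ c).1, vonNeumannEntropy]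
    refine tendsto_finsetSum _ fun i _ => ?_
    rw [tendsto_iff_norm_sub_tendsto_zero]
    refine squeeze_zero (fun _ => norm_nonneg _) (fun N => ?_)
      tendsto_one_div_add_atTop_nhds_zero_nat
    exact (hp N _ ⟨(hρ c).eigenvalues_nonneg i, eigenvalues_le_one (hρ c) (htr c) i⟩).le

end Entropy

end RandomMERA

namespace RandomMERA

open Matrix Finset
open scoped ComplexConjugate

/-! ## Second moments of Haar isometries -/

section Haar

set_option linter.unusedSectionVars false

variable {m n : Type} [Fintype m] [DecidableEq m] [DecidableEq n]

/-- Inherited from left invariance of Haar measure on the unitary group. Apart from total mass one,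
this is the property of the distribution from which the second moments are found. -/
theorem integral_unitaryMul_haarIsometry (U : Matrix.unitaryGroup m ℂ)
    (f : IsometryMatrix m n → ℂ) (hf : Continuous f) :
    ∫ W, f (unitaryMul U W) ∂haarIsometry m n = ∫ W, f W ∂haarIsometry m n := by
  have hc : ∀ W₀ : IsometryMatrix m n,
      Continuous fun U : Matrix.unitaryGroup m ℂ => unitaryMul U W₀ := by
    intro W₀
    unfold unitaryMul
    fun_prop
  have hc' : Continuous fun W : IsometryMatrix m n => unitaryMul U W := by
    unfold unitaryMul
    fun_prop
  unfold haarIsometry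
  split_ifs with h
  · rw [integral_map (f := fun W => f (unitaryMul U W)) (hc _).aemeasurable
        (hf.comp hc').aestronglyMeasurable,
      integral_map (hc _).aemeasurable hf.aestronglyMeasurable]
    have e : ∀ V : Matrix.unitaryGroup m ℂ,
        unitaryMul U (unitaryMul V h.some) = unitaryMul (U * V) h.some := by
      intro V
      apply Subtype.ext
      simp [unitaryMul, Matrix.mul_assoc]
    simp only [e]
    exact integral_mul_left_eq_self (fun V => f (unitaryMul V h.some)) U
  · simp

theorem norm_isometryMatrix_le_one (W : IsometryMatrix m n) (i : m) (a : n) : ‖W.1 i a‖ ≤ 1 := by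
  have h := congrFun (congrFun W.2 a) a
  simp only [Matrix.mul_apply, Matrix.conjTranspose_apply, Matrix.one_apply_eq, RCLike.star_def,
    Complex.conj_mul'] at h
  have h' : ∑ i, ‖W.1 i a‖ ^ 2 = 1 := by exact_mod_cast h
  have := Finset.single_le_sum (f := fun i => ‖W.1 i a‖ ^ 2) (fun j _ => by positivity)
    (Finset.mem_univ i)
  rw [h'] at this
  exact (sq_le_one_iff₀ (norm_nonneg _)).mp this

theorem continuous_isometryMatrix_apply (i : m) (a : n) :
    Continuous fun W : IsometryMatrix m n => W.1 i a :=
  (continuous_apply_apply i a).comp continuous_subtype_val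

/-- The degree `(2, 2)` monomials in the entries of an isometry. -/
def monomial22 (a b c e : n) (i j k l : m) (W : IsometryMatrix m n) : ℂ :=
  W.1 i a * W.1 j b * conj (W.1 k c) * conj (W.1 l e)

theorem continuous_monomial22 (a b c e : n) (i j k l : m) :
    Continuous (monomial22 a b c e i j k l) := by
  have h := fun (i : m) (a : n) => continuous_isometryMatrix_apply i a
  exact (((h i a).mul (h j b)).mul (Complex.continuous_conj.comp (h k c))).mul
    (Complex.continuous_conj.comp (h l e))

theorem integrable_monomial22 (a b c e : n) (i j k l : m) :
    Integrable (monomial22 a b c e i j k l) (haarIsometry m n) := by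
  refine Integrable.of_bound (continuous_monomial22 a b c e i j k l).aestronglyMeasurable 1
    (Filter.Eventually.of_forall fun W => ?_)
  have h := norm_isometryMatrix_le_one W
  simp only [monomial22, norm_mul, RCLike.norm_conj]
  exact mul_le_one₀ (mul_le_one₀ (mul_le_one₀ (h i a) (norm_nonneg _) (h j b)) (norm_nonneg _)
    (h k c)) (norm_nonneg _) (h l e)

/-- The second moments of a Haar isometry. -/
noncomputable def haarMoment (a b c e : n) (i j k l : m) : ℂ :=
  ∫ W, monomial22 a b c e i j k l W ∂haarIsometry m n

theorem haarMoment_swap (a b c e : n) (i j k l : m) :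
    haarMoment a b c e i j k l = haarMoment a b e c i j l k := by
  unfold haarMoment monomial22
  congr 1
  ext W
  ring

/-- The nested form on the right lets a sparse row of a unitary be evaluated one index at a time. -/
theorem sum_mul_sum_mul_sum_mul_sum (p q r s x y z w : m → ℂ) :
    (∑ i, p i * x i) * (∑ j, q j * y j) * (∑ k, r k * z k) * (∑ l, s l * w l) =
      ∑ i, p i * ∑ j, q j * ∑ k, r k * ∑ l, s l * (x i * y j * z k * w l) := by
  have e : ∀ (f g : m → ℂ) (c e : ℂ), ∑ t, f t * (c * g t * e) = c * (∑ t, f t * g t) * e := by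
    intro f g c e
    rw [Finset.mul_sum, Finset.sum_mul]
    exact Finset.sum_congr rfl fun t _ => by ring
  have e1 := fun c => e s w c 1
  simp only [mul_one] at e1
  have e4 := fun c => e p x 1 c
  simp only [one_mul] at e4
  simp only [e1]
  have e2 := fun c => e r z c (∑ l, s l * w l)
  simp only [e2]
  simp only [mul_assoc] at e e4 ⊢
  simp only [e, e4]

/-- The moment tensor is invariant under `V ⊗ V ⊗ V̄ ⊗ V̄`. Three kinds of `V` then determine its
form: diagonal phases, permutations, and one unitary mixing two basis vectors. -/
theorem haarMoment_unitary (V : Matrix.unitaryGroup m ℂ) (a b c e : n) (i j k l : m) :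
    haarMoment a b c e i j k l = ∑ i', V.1 i i' * ∑ j', V.1 j j' * ∑ k', conj (V.1 k k') *
      ∑ l', conj (V.1 l l') * haarMoment a b c e i' j' k' l' := by
  have h : haarMoment a b c e i j k l =
      ∫ W, ∑ i', V.1 i i' * ∑ j', V.1 j j' * ∑ k', conj (V.1 k k') *
      ∑ l', conj (V.1 l l') * monomial22 a b c e i' j' k' l' W ∂haarIsometry m n := by
    rw [haarMoment, ← integral_unitaryMul_haarIsometry V _ (continuous_monomial22 a b c e i j k l)]
    congr 1
    ext W
    simp only [monomial22, unitaryMul, Matrix.mul_apply, map_sum, map_mul]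
    exact sum_mul_sum_mul_sum_mul_sum _ _ _ _ _ _ _ _
  rw [h]
  have h1 := fun i j k l => integrable_monomial22 (m := m) a b c e i j k l
  have h2 := fun i j k => integrable_finsetSum Finset.univ fun l' _ =>
    (h1 i j k l').const_mul (conj (V.1 l l'))
  have h3 := fun i j => integrable_finsetSum Finset.univ fun k' _ =>
    (h2 i j k').const_mul (conj (V.1 k k'))
  have h4 := fun i => integrable_finsetSum Finset.univ fun j' _ =>
    (h3 i j').const_mul (V.1 j j')
  rw [integral_finsetSum _ fun i' _ => (h4 i').const_mul (V.1 i i')]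
  refine Finset.sum_congr rfl fun i' _ => ?_
  rw [integral_const_mul, integral_finsetSum _ fun j' _ => (h3 i' j').const_mul (V.1 j j')]
  congr 1
  refine Finset.sum_congr rfl fun j' _ => ?_
  rw [integral_const_mul, integral_finsetSum _ fun k' _ => (h2 i' j' k').const_mul _]
  congr 1
  refine Finset.sum_congr rfl fun k' _ => ?_
  rw [integral_const_mul, integral_finsetSum _ fun l' _ => (h1 i' j' k' l').const_mul _]
  congr 1
  refine Finset.sum_congr rfl fun l' _ => ?_
  rw [integral_const_mul, haarMoment]

theorem haarMoment_phase (v : m → ℂ) (hv : ∀ i, v i * conj (v i) = 1) (a b c e : n)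
    (i j k l : m) : haarMoment a b c e i j k l =
      v i * v j * conj (v k) * conj (v l) * haarMoment a b c e i j k l := by
  have hV : Matrix.diagonal v ∈ Matrix.unitaryGroup m ℂ := by
    rw [Matrix.mem_unitaryGroup_iff, Matrix.star_eq_conjTranspose, Matrix.diagonal_conjTranspose,
      Matrix.diagonal_mul_diagonal, ← Matrix.diagonal_one]
    congr 1
    ext i
    exact hv i
  conv_lhs => rw [haarMoment_unitary ⟨_, hV⟩]
  simp only [Matrix.diagonal_apply, apply_ite conj, map_zero, ite_mul, zero_mul,
    Finset.sum_ite_eq, Finset.mem_univ, if_true]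
  ring

theorem haarMoment_perm (π : Equiv.Perm m) (a b c e : n) (i j k l : m) :
    haarMoment a b c e i j k l = haarMoment a b c e (π i) (π j) (π k) (π l) := by
  have hV : π.permMatrix ℂ ∈ Matrix.unitaryGroup m ℂ := by
    rw [Matrix.mem_unitaryGroup_iff, Matrix.star_eq_conjTranspose, Matrix.conjTranspose_permMatrix,
      ← Matrix.permMatrix_mul]
    simp
  rw [haarMoment_unitary ⟨_, hV⟩]
  simp [Equiv.Perm.permMatrix, PEquiv.toMatrix_apply, apply_ite conj]

/-- If `{i, j}` and `{k, l}` differ as multisets, some basis vector occurs a different number of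
times in them. Giving it the phase `I` multiplies the moment by a power of `I` with nonzero exponent
between `-2` and `2`, hence different from one. The phase `-1` would miss exponent two. -/
theorem haarMoment_eq_zero (a b c e : n) {i j k l : m}
    (h1 : ¬ (i = k ∧ j = l)) (h2 : ¬ (i = l ∧ j = k)) : haarMoment a b c e i j k l = 0 := by
  by_contra hne
  have key : ∀ x : m, (if i = x then Complex.I else 1) * (if j = x then Complex.I else 1) *
      conj (if k = x then Complex.I else 1) * conj (if l = x then Complex.I else 1) = 1 := by
    intro x
    have h := haarMoment_phase (fun t => if t = x then Complex.I else 1)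
      (fun t => by split_ifs <;> simp) a b c e i j k l
    exact (mul_right_cancel₀ hne ((one_mul _).trans h)).symm
  have hI : Complex.I ≠ 1 := fun h => by simpa using congrArg Complex.re h
  have hI' : -Complex.I ≠ 1 := fun h => by simpa using congrArg Complex.re h
  have hI2 : (-1 : ℂ) ≠ 1 := by norm_num
  have ki := key i
  have kj := key j
  have kl := key l
  by_cases hik : i = k
  · subst hik
    have hjl : j ≠ l := fun h => h1 ⟨rfl, h⟩
    by_cases hij : i = j
    · subst hij
      simp [hjl, hI'] at kl
    · simp [hij, hjl.symm, hI] at kj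
  · by_cases hil : i = l
    · subst hil
      have hjk : j ≠ k := fun h => h2 ⟨rfl, h⟩
      have kk := key k
      by_cases hij : i = j
      · subst hij
        simp [hjk, hI'] at kk
      · simp [hij, hjk.symm, hI] at kj
    · by_cases hij : i = j
      · subst hij
        simp [Ne.symm hik, Ne.symm hil, hI2] at ki
      · simp [Ne.symm hij, Ne.symm hik, Ne.symm hil, hI] at ki

/-- Invariance under a unitary mixing `x` and `y` with equal moduli, together with the vanishing
moments, gives `γ = γ / 2 + (α + β) / 2`. -/
theorem haarMoment_diag (a b c e : n) {x y : m} (hxy : x ≠ y) :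
    haarMoment a b c e x x x x = haarMoment a b c e x y x y + haarMoment a b c e x y y x := by
  -- With `u = e_x + e_y`, the matrix `1 - z u uᵀ` is unitary when `z + z̄ = 2 |z| ^ 2`. This `z`
  -- also satisfies `|z| ^ 2 = |1 - z| ^ 2 = 1 / 2`, so the mixing is balanced.
  set z : ℂ := ⟨1 / 2, -1 / 2⟩ with hz
  set u : m → ℂ := fun t => if t = x ∨ t = y then 1 else 0 with hu
  have huu : u ⬝ᵥ u = 2 := by
    have : ∀ t, u t * u t = (if t = x then 1 else 0) + (if t = y then 1 else 0) := by
      intro t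
      simp only [hu]
      by_cases h1 : t = x
      · subst h1; simp [hxy]
      · simp [h1]
    simp only [dotProduct, this, Finset.sum_add_distrib]
    simp
    norm_num
  have hzz : z + conj z = 2 * (z * conj z) := by
    rw [hz]
    apply Complex.ext <;> simp <;> norm_num
  have hV : (1 - z • vecMulVec u u : Matrix m m ℂ) ∈ Matrix.unitaryGroup m ℂ := by
    have hstar : (vecMulVec u u)ᴴ = vecMulVec u u := by
      ext i j
      simp only [hu, Matrix.conjTranspose_apply, Matrix.vecMulVec_apply]
      split_ifs <;> simp
    rw [Matrix.mem_unitaryGroup_iff, Matrix.star_eq_conjTranspose, Matrix.conjTranspose_sub,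
      Matrix.conjTranspose_smul, hstar, Matrix.conjTranspose_one, Matrix.sub_mul, Matrix.mul_sub,
      Matrix.mul_sub]
    simp only [Matrix.mul_one, Matrix.one_mul, Matrix.smul_mul, Matrix.mul_smul,
      Matrix.vecMulVec_mul_vecMulVec, huu, Matrix.vecMulVec_smul, RCLike.star_def]
    have : (z • conj z • (2 : ℂ) • vecMulVec u u : Matrix m m ℂ)
        = z • vecMulVec u u + conj z • vecMulVec u u := by
      rw [← add_smul, hzz, smul_smul, smul_smul]
      congr 1
      ring
    rw [smul_comm (conj z) z, this]
    abel
  have hrow : ∀ G : m → ℂ,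
      ∑ t, (1 - z • vecMulVec u u : Matrix m m ℂ) x t * G t = (1 - z) * G x - z * G y := by
    intro G
    have : ∀ t, (1 - z • vecMulVec u u : Matrix m m ℂ) x t * G t =
        (if t = x then (1 - z) * G t else 0) - (if t = y then z * G t else 0) := by
      intro t
      simp only [hu, Matrix.sub_apply, Matrix.smul_apply, Matrix.vecMulVec_apply, Matrix.one_apply]
      by_cases h1 : t = x
      · subst h1; simp [hxy]
      · by_cases h2 : t = y
        · subst h2; simp [h1, Ne.symm h1]
        · simp [h1, h2, Ne.symm h1]
    simp only [this, Finset.sum_sub_distrib]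
    simp
  have hrow' : ∀ G : m → ℂ, ∑ t, conj ((1 - z • vecMulVec u u : Matrix m m ℂ) x t) * G t
      = (1 - conj z) * G x - conj z * G y := by
    intro G
    have := congrArg conj (hrow fun t => conj (G t))
    simpa using this
  have h := haarMoment_unitary ⟨_, hV⟩ a b c e x x x x
  simp only [hrow, hrow'] at h
  have hyx := hxy.symm
  have g : haarMoment a b c e y y y y = haarMoment a b c e x x x x := by
    simpa using haarMoment_perm (Equiv.swap x y) a b c e y y y y
  have p1 : haarMoment a b c e y x y x = haarMoment a b c e x y x y := by
    simpa using haarMoment_perm (Equiv.swap x y) a b c e y x y x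
  have p2 : haarMoment a b c e y x x y = haarMoment a b c e x y y x := by
    simpa using haarMoment_perm (Equiv.swap x y) a b c e y x x y
  have z1 := haarMoment_eq_zero a b c e (i := x) (j := x) (k := x) (l := y)
    (by simp [hxy]) (by simp [hxy])
  have z2 := haarMoment_eq_zero a b c e (i := x) (j := x) (k := y) (l := x)
    (by simp [hxy]) (by simp [hxy])
  have z3 := haarMoment_eq_zero a b c e (i := x) (j := y) (k := x) (l := x)
    (by simp [hyx]) (by simp [hyx])
  have z4 := haarMoment_eq_zero a b c e (i := y) (j := x) (k := x) (l := x)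
    (by simp [hyx]) (by simp [hyx])
  have z5 := haarMoment_eq_zero a b c e (i := y) (j := y) (k := y) (l := x)
    (by simp [hyx]) (by simp [hyx])
  have z6 := haarMoment_eq_zero a b c e (i := y) (j := y) (k := x) (l := y)
    (by simp [hyx]) (by simp [hyx])
  have z7 := haarMoment_eq_zero a b c e (i := y) (j := x) (k := y) (l := y)
    (by simp [hxy]) (by simp [hxy])
  have z8 := haarMoment_eq_zero a b c e (i := x) (j := y) (k := y) (l := y)
    (by simp [hxy]) (by simp [hxy])
  have z9 := haarMoment_eq_zero a b c e (i := x) (j := x) (k := y) (l := y)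
    (by simp [hxy]) (by simp [hxy])
  have z10 := haarMoment_eq_zero a b c e (i := y) (j := y) (k := x) (l := x)
    (by simp [hyx]) (by simp [hyx])
  rw [z1, z2, z3, z4, z5, z6, z7, z8, z9, z10, g, p1, p2] at h
  have hn : z * conj z = 1 / 2 := by
    rw [hz]
    apply Complex.ext <;> simp <;> norm_num
  have hn' : (1 - z) * (1 - conj z) = 1 / 2 := by
    rw [hz]
    apply Complex.ext <;> simp <;> norm_num
  set γ := haarMoment a b c e x x x x
  set α := haarMoment a b c e x y x y
  set β := haarMoment a b c e x y y x
  have h' : γ = ((1 - z) * (1 - conj z)) ^ 2 * γ + (z * conj z) ^ 2 * γ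
      + 2 * ((1 - z) * (1 - conj z)) * (z * conj z) * (α + β) := by
    refine h.trans ?_
    ring
  rw [hn, hn'] at h'
  linear_combination 2 * h'

/-- The second moments of a Haar isometry are a combination of the two permutations of the row
indices. -/
theorem exists_haarMoment_eq (a b c e : n) : ∃ α β : ℂ, ∀ i j k l : m,
    haarMoment a b c e i j k l =
      α * (if i = k ∧ j = l then 1 else 0) + β * (if i = l ∧ j = k then 1 else 0) := by
  rcases subsingleton_or_nontrivial m with hm | hm
  · rcases isEmpty_or_nonempty m with h0 | ⟨⟨x⟩⟩
    · exact ⟨0, 0, fun i => isEmptyElim i⟩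
    -- With a single row the two pairings coincide and only `α + β` is determined, so `β = 0` is a
    -- choice.
    · refine ⟨haarMoment a b c e x x x x, 0, fun i j k l => ?_⟩
      rw [Subsingleton.elim i x, Subsingleton.elim j x, Subsingleton.elim k x,
        Subsingleton.elim l x]
      simp
  · obtain ⟨x, y, hxy⟩ := exists_pair_ne m
    refine ⟨haarMoment a b c e x y x y, haarMoment a b c e x y y x, fun i j k l => ?_⟩
    have hmove : ∀ i j : m, i ≠ j →
        haarMoment a b c e i j i j = haarMoment a b c e x y x y ∧
        haarMoment a b c e i j j i = haarMoment a b c e x y y x := by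
      intro i j hij
      -- Permutations act two-transitively, so a single off-diagonal pair fixes both coefficients.
      obtain ⟨π, h1, h2⟩ := MulAction.is_two_pretransitive_iff.mp
        (Equiv.Perm.isMultiplyPretransitive m 2) hij hxy
      simp only [Equiv.Perm.smul_def] at h1 h2
      rw [haarMoment_perm π a b c e i j i j, haarMoment_perm π a b c e i j j i, h1, h2]
      exact ⟨rfl, rfl⟩
    by_cases hij : i = j
    · subst hij
      by_cases h : i = k ∧ i = l
      · obtain ⟨rfl, rfl⟩ := h
        obtain ⟨y', hy'⟩ := exists_ne i
        rw [haarMoment_diag a b c e hy'.symm, (hmove _ _ hy'.symm).1, (hmove _ _ hy'.symm).2]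
        simp
      · rw [haarMoment_eq_zero a b c e h fun h' => h ⟨h'.2, h'.1⟩, if_neg h,
          if_neg fun h' => h ⟨h'.2, h'.1⟩]
        simp
    · by_cases h1 : i = k ∧ j = l
      · obtain ⟨rfl, rfl⟩ := h1
        rw [(hmove i j hij).1]
        simp [hij]
      · by_cases h2 : i = l ∧ j = k
        · obtain ⟨rfl, rfl⟩ := h2
          rw [(hmove i j hij).2]
          simp [hij]
        · rw [haarMoment_eq_zero a b c e h1 h2]
          simp [h1, h2]

theorem isometry_column_inner (W : IsometryMatrix m n) (a c : n) :
    ∑ i, W.1 i a * conj (W.1 i c) = if a = c then 1 else 0 := by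
  have h := congrFun (congrFun W.2 c) a
  simp only [Matrix.mul_apply, Matrix.conjTranspose_apply, Matrix.one_apply, RCLike.star_def] at h
  rw [Finset.sum_congr rfl fun i _ => mul_comm _ _, h]
  simp [eq_comm]

/-- This contraction of the row indices produces inner products of columns, which are the same for
every isometry, so the integrand is constant. -/
theorem sum_haarMoment_id [Nonempty (IsometryMatrix m n)] (a b c e : n) :
    ∑ i : m, ∑ j : m, haarMoment a b c e i j i j =
      (if a = c then 1 else 0) * (if b = e then 1 else 0) := by
  have := isProbabilityMeasure_haarIsometry m n
  have h : ∀ W : IsometryMatrix m n, ∑ i, ∑ j, monomial22 a b c e i j i j W =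
      (if a = c then 1 else 0) * (if b = e then 1 else 0) := by
    intro W
    rw [← isometry_column_inner W, ← isometry_column_inner W, Finset.sum_mul_sum]
    refine Finset.sum_congr rfl fun i _ => Finset.sum_congr rfl fun j _ => ?_
    simp only [monomial22]
    ring
  unfold haarMoment
  simp_rw [← integral_finsetSum Finset.univ fun j _ => integrable_monomial22 a b c e _ j _ j]
  rw [← integral_finsetSum Finset.univ fun i _ => integrable_finsetSum Finset.univ fun j _ =>
    integrable_monomial22 a b c e i j i j]
  simp only [h]
  simp

theorem sum_haarMoment_swap [Nonempty (IsometryMatrix m n)] (a b c e : n) :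
    ∑ i : m, ∑ j : m, haarMoment a b c e i j j i =
      (if a = e then 1 else 0) * (if b = c then 1 else 0) := by
  rw [← sum_haarMoment_id (m := m) a b e c]
  exact Finset.sum_congr rfl fun i _ => Finset.sum_congr rfl fun j _ =>
    haarMoment_swap _ _ _ _ _ _ _ _

end Haar

/-! ### Swapping one of the two output sites -/

section HalfSwap

variable {d : ℕ} {n : Type} [DecidableEq n]

/-- Averaging the swap of one half of the output of a Haar isometry. -/
theorem sum_haarMoment_halfSwap_left [Nonempty (IsometryMatrix (Fin d × Fin d) n)] (hd : 0 < d)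
    (a b c e : n) :
    ∑ z : Fin d × Fin d, ∑ z' : Fin d × Fin d, haarMoment a b c e z z' (z'.1, z.2) (z.1, z'.2) =
      (d / (d ^ 2 + 1) : ℝ) * ((if a = c then 1 else 0) * (if b = e then 1 else 0) +
        (if a = e then 1 else 0) * (if b = c then 1 else 0)) := by
  obtain ⟨α, β, h⟩ := exists_haarMoment_eq (m := Fin d × Fin d) a b c e
  -- With `d ^ 2` rows, the identity contraction is `α d ^ 4 + β d ^ 2`, the swap contraction `α d ^
  -- 2 + β d ^ 4`, and the half swap `(α + β) d ^ 3`. The last is `d / (d ^ 2 + 1)` times the sum of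
  -- the others, so `α` and `β` need not be solved for.
  rw [← sum_haarMoment_id (m := Fin d × Fin d), ← sum_haarMoment_swap (m := Fin d × Fin d)]
  have e0 : ∀ p q : Prop, [Decidable p] → [Decidable q] → (if p ∧ q then (1 : ℂ) else 0) =
      (if p then 1 else 0) * (if q then 1 else 0) := by
    intro p q _ _
    by_cases p <;> by_cases q <;> simp [*]
  simp only [h, Fintype.sum_prod_type, Prod.ext_iff, Finset.sum_add_distrib, ← Finset.mul_sum, e0]
  simp
  have hd' : (d : ℂ) ^ 2 + 1 ≠ 0 := by
    exact_mod_cast (by positivity : (d : ℝ) ^ 2 + 1 ≠ 0)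
  field_simp
  ring

theorem sum_haarMoment_halfSwap_right [Nonempty (IsometryMatrix (Fin d × Fin d) n)] (hd : 0 < d)
    (a b c e : n) :
    ∑ z : Fin d × Fin d, ∑ z' : Fin d × Fin d, haarMoment a b c e z z' (z.1, z'.2) (z'.1, z.2) =
      (d / (d ^ 2 + 1) : ℝ) * ((if a = c then 1 else 0) * (if b = e then 1 else 0) +
        (if a = e then 1 else 0) * (if b = c then 1 else 0)) := by
  have := sum_haarMoment_halfSwap_left hd a b e c
  rw [add_comm ((if a = c then (1 : ℂ) else 0) * _), ← this]
  exact Finset.sum_congr rfl fun i _ => Finset.sum_congr rfl fun j _ =>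
    haarMoment_swap _ _ _ _ _ _ _ _

end HalfSwap

end RandomMERA

namespace RandomMERA

open Matrix Finset
open scoped ComplexConjugate ComplexOrder

set_option linter.unusedSectionVars false

/-! ## Entropies of pure states -/

section States

variable {ι α : Type} [Fintype ι] [DecidableEq ι] [Fintype α] [DecidableEq α]

/-- The configuration with given values on `A` and outside of `A`. -/
abbrev joinConfig (A : Finset ι) (x : {s // s ∈ A} → α) (z : {s // s ∉ A} → α) : ι → α :=
  (Equiv.piEquivPiSubtypeProd (· ∈ A) fun _ => α).symm (x, z)

theorem joinConfig_apply (A : Finset ι) (x : {s // s ∈ A} → α) (z : {s // s ∉ A} → α) (s : ι) :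
    joinConfig A x z s = if h : s ∈ A then x ⟨s, h⟩ else z ⟨s, h⟩ := rfl

/-- The amplitudes of a vector as a matrix, rows for `A` and columns for the complement. -/
def bipartite (A : Finset ι) (v : (ι → α) → ℂ) :
    Matrix ({s // s ∈ A} → α) ({s // s ∉ A} → α) ℂ := fun x z => v (joinConfig A x z)

theorem reduced_density_eq (A : Finset ι) (v : (ι → α) → ℂ) :
    reduced A (density v) = bipartite A v * (bipartite A v)ᴴ := by
  ext x x'
  simp [reduced, density, Matrix.vecMulVec_apply, Matrix.mul_apply, bipartite]

theorem posSemidef_reduced_density (A : Finset ι) (v : (ι → α) → ℂ) :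
    (reduced A (density v)).PosSemidef := by
  rw [reduced_density_eq]
  exact Matrix.posSemidef_self_mul_conjTranspose _

theorem trace_reduced_density (A : Finset ι) (v : (ι → α) → ℂ) :
    (reduced A (density v)).trace = ∑ x, v x * conj (v x) := by
  rw [← (Equiv.piEquivPiSubtypeProd (· ∈ A) fun _ => α).symm.sum_comp, Fintype.sum_prod_type]
  rfl

/-- The entropy of the set of sites `A` in the pure state `v`. -/
noncomputable def setEntropy (A : Finset ι) (v : (ι → α) → ℂ) : ℝ :=
  specEntropy (reduced A (density v))

/-- Schmidt decomposition: with the amplitude matrix `M`, the two reduced matrices are `M Mᴴ` and,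
up to relabelling, the transpose of `Mᴴ M`. -/
theorem setEntropy_compl (A : Finset ι) (v : (ι → α) → ℂ) :
    setEntropy Aᶜ v = setEntropy A v := by
  let e1 : ({s // s ∈ Aᶜ} → α) ≃ ({s // s ∉ A} → α) :=
    Equiv.piCongrLeft (fun _ => α) (Equiv.subtypeEquivRight fun s => Finset.mem_compl)
  let e2 : ({s // s ∉ Aᶜ} → α) ≃ ({s // s ∈ A} → α) :=
    Equiv.piCongrLeft (fun _ => α) (Equiv.subtypeEquivRight fun s => by simp)
  have h : bipartite Aᶜ v = ((bipartite A v)ᵀ).submatrix e1 e2 := by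
    ext x z
    simp only [bipartite, Matrix.submatrix_apply, Matrix.transpose_apply]
    congr 1
    ext s
    simp only [joinConfig_apply]
    by_cases hs : s ∈ A
    · simp only [hs, e2, Equiv.piCongrLeft_apply, Finset.mem_compl, not_true, dite_true, dite_false]
      rfl
    · simp only [hs, e1, Equiv.piCongrLeft_apply, Finset.mem_compl, not_false_eq_true, dite_true,
        dite_false]
      rfl
  rw [setEntropy, setEntropy, reduced_density_eq, reduced_density_eq, h,
    Matrix.conjTranspose_submatrix, Matrix.submatrix_mul_equiv, specEntropy_submatrix,
    ← specEntropy_transpose, Matrix.transpose_mul, Matrix.transpose_transpose,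
    specEntropy_mul_comm (bipartite A v)]
  rfl

/-- Subadditivity, with the entropy of the new site bounded by its maximum. The equivalences `e` and
`f` split off the coordinate `x` from the kept and from the traced sites respectively. -/
theorem setEntropy_insert_le [Nonempty α] (A : Finset ι) (x : ι) {v : (ι → α) → ℂ}
    (hv : ∑ y, v y * conj (v y) = 1) :
    setEntropy (insert x A) v ≤ setEntropy A v + Real.log (Fintype.card α) := by
  have hlog : 0 ≤ Real.log (Fintype.card α) :=
    Real.log_nonneg (by exact_mod_cast Fintype.card_pos)
  by_cases hx : x ∈ A
  · rw [Finset.insert_eq_of_mem hx]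
    linarith
  let e : ({s // s ∈ A} → α) × α ≃ ({s // s ∈ insert x A} → α) :=
    { toFun := fun p s => if h : s.1 ∈ A then p.1 ⟨s.1, h⟩ else p.2
      invFun := fun y => (fun s => y ⟨s.1, Finset.mem_insert_of_mem s.2⟩,
        y ⟨x, Finset.mem_insert_self x A⟩)
      left_inv := fun p => by simp [hx]
      right_inv := fun y => by
        ext s
        by_cases h : s.1 ∈ A
        · simp [h]
        · have : s = ⟨x, Finset.mem_insert_self x A⟩ :=
            Subtype.ext ((Finset.mem_insert.mp s.2).resolve_right h)
          subst this
          simp [h] }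
  let f : α × ({s // s ∉ insert x A} → α) ≃ ({s // s ∉ A} → α) :=
    { toFun := fun p s => if h : s.1 = x then p.1 else
        p.2 ⟨s.1, fun h' => (Finset.mem_insert.mp h').elim h s.2⟩
      invFun := fun y => (y ⟨x, hx⟩, fun s => y ⟨s.1, fun h => s.2 (Finset.mem_insert_of_mem h)⟩)
      left_inv := fun p => by
        refine Prod.ext (by simp) ?_
        ext s
        have : s.1 ≠ x := fun h => s.2 (Finset.mem_insert.mpr (Or.inl h))
        simp [this]
      right_inv := fun y => by
        ext s
        by_cases h : s.1 = x
        · have : s = ⟨x, hx⟩ := Subtype.ext h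
          subst this
          simp
        · simp [h] }
  have hjoin : ∀ y b z, joinConfig (insert x A) (e (y, b)) z = joinConfig A y (f (b, z)) := by
    intro y b z
    ext s
    simp only [joinConfig_apply]
    by_cases h : s ∈ A
    · simp [h, e]
    · by_cases h' : s = x
      · subst h'
        simp [h, e, f]
      · simp [h, h', f]
  have hpsd := (posSemidef_reduced_density (insert x A) v).submatrix e
  have htr : ((reduced (insert x A) (density v)).submatrix e e).trace = 1 := by
    rw [← hv, ← trace_reduced_density (insert x A)]
    exact e.sum_comp fun i => (reduced (insert x A) (density v)) i i
  have h := specEntropy_le_partialTrace hpsd htr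
  rw [specEntropy_submatrix] at h
  refine h.trans (le_of_eq ?_)
  rw [setEntropy]
  congr 2
  ext i j
  simp only [Matrix.of_apply, Matrix.submatrix_apply, reduced, density, Matrix.vecMulVec_apply]
  rw [← f.sum_comp, Fintype.sum_prod_type]
  refine Finset.sum_congr rfl fun b _ => Finset.sum_congr rfl fun z _ => ?_
  exact congrArg₂ (fun a b => v a * star (v b)) (hjoin i b z) (hjoin j b z)

/-- Removing a site from a set adds it to the complement, which has the same entropy because the
state is pure. -/
theorem setEntropy_le_insert [Nonempty α] (A : Finset ι) (x : ι) {v : (ι → α) → ℂ}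
    (hv : ∑ y, v y * conj (v y) = 1) :
    setEntropy A v ≤ setEntropy (insert x A) v + Real.log (Fintype.card α) := by
  have hlog : 0 ≤ Real.log (Fintype.card α) :=
    Real.log_nonneg (by exact_mod_cast Fintype.card_pos)
  by_cases hx : x ∈ A
  · rw [Finset.insert_eq_of_mem hx]
    linarith
  have h := setEntropy_insert_le (insert x A)ᶜ x hv
  rw [setEntropy_compl] at h
  have e : insert x (insert x A)ᶜ = Aᶜ := by
    ext s
    by_cases hs : s = x
    · subst hs; simp [hx]
    · simp [hs]
  rwa [e, setEntropy_compl] at h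

theorem setEntropy_empty {v : (ι → α) → ℂ} (hv : ∑ y, v y * conj (v y) = 1) :
    setEntropy (∅ : Finset ι) v = 0 := by
  have h0 := specEntropy_nonneg (posSemidef_reduced_density ∅ v)
    ((trace_reduced_density ∅ v).trans hv)
  refine le_antisymm ?_ h0
  have h := specEntropy_le_diag (posSemidef_reduced_density ∅ v)
  refine h.trans (le_of_eq ?_)
  have ht := (trace_reduced_density ∅ v).trans hv
  rw [Matrix.trace, Fintype.sum_unique] at ht
  rw [Fintype.sum_unique]
  rw [Matrix.diag] at ht
  rw [ht]
  simp

theorem setEntropy_univ {v : (ι → α) → ℂ} (hv : ∑ y, v y * conj (v y) = 1) :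
    setEntropy (Finset.univ : Finset ι) v = 0 := by
  rw [← setEntropy_compl, Finset.compl_univ, setEntropy_empty hv]

end States

/-! ## Layers of isometries -/

section Gates

variable {ι τ α β γ : Type} [Fintype ι] [DecidableEq ι] [Fintype τ] [DecidableEq τ]
  [Fintype α] [DecidableEq α] [Fintype β] [DecidableEq β] [Fintype γ] [DecidableEq γ]

/-- A product of matrices, one for each site, applied to a vector. -/
def gate (W : ι → Matrix γ β ℂ) (v : (ι → β) → ℂ) : (ι → γ) → ℂ := fun z =>
  ∑ x : ι → β, (∏ s, W s (z s) (x s)) * v x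

theorem sum_sum_prod_eq {κ : Type} [Fintype κ] [DecidableEq κ] {R : Type*} [CommSemiring R]
    (f : ι → κ → R) : ∑ z : ι → κ, ∏ s, f s (z s) = ∏ s, ∑ a, f s a := by
  rw [Finset.prod_univ_sum, Fintype.piFinset_univ]

/-- The tensor product of matrices. -/
def tensor (W : ι → Matrix γ β ℂ) : Matrix (ι → γ) (ι → β) ℂ := fun z x => ∏ s, W s (z s) (x s)

theorem tensor_isometry (W : ι → Matrix γ β ℂ) (hW : ∀ s, (W s)ᴴ * W s = 1) :
    (tensor W)ᴴ * tensor W = 1 := by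
  ext x x'
  have h : ∀ s, ∑ a, conj (W s a (x s)) * W s a (x' s) = if x s = x' s then 1 else 0 := by
    intro s
    have := congrFun (congrFun (hW s) (x s)) (x' s)
    simpa [Matrix.mul_apply, Matrix.one_apply] using this
  simp only [Matrix.mul_apply, Matrix.conjTranspose_apply, tensor, RCLike.star_def, map_prod,
    ← Finset.prod_mul_distrib]
  rw [sum_sum_prod_eq fun s a => conj (W s a (x s)) * W s a (x' s)]
  simp only [h, Matrix.one_apply]
  rw [Finset.prod_ite_zero]
  simp [funext_iff]

theorem bipartite_gate (W : ι → Matrix γ β ℂ) (v : (ι → β) → ℂ) (T : Finset ι) :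
    bipartite T (gate W v) = tensor (fun s : {s // s ∈ T} => W s) * bipartite T v *
      (tensor (fun s : {s // s ∉ T} => W s))ᵀ := by
  ext x z
  rw [Matrix.mul_apply]
  simp only [bipartite, gate, Matrix.mul_apply, Finset.sum_mul, Matrix.transpose_apply]
  rw [← (Equiv.piEquivPiSubtypeProd (· ∈ T) fun _ => β).symm.sum_comp, Fintype.sum_prod_type,
    Finset.sum_comm]
  refine Finset.sum_congr rfl fun z' _ => Finset.sum_congr rfl fun x' _ => ?_
  rw [← Fintype.prod_subtype_mul_prod_subtype (· ∈ T)]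
  have h1 : ∀ s : {s // s ∈ T}, joinConfig T x z s.1 = x s := fun s => by
    simp
  have h2 : ∀ s : {s // s ∉ T}, joinConfig T x z s.1 = z s := fun s => by
    simp [s.2]
  have h3 : ∀ s : {s // s ∈ T}, joinConfig T x' z' s.1 = x' s := fun s => by
    simp
  have h4 : ∀ s : {s // s ∉ T}, joinConfig T x' z' s.1 = z' s := fun s => by
    simp [s.2]
  simp only [h1, h2, h3, h4, tensor]
  rw [mul_right_comm]
  congr!

/-- A product of gates factors across the cut between `T` and its complement. The isometries outside
`T` cancel in the partial trace, and those inside act by conjugation. -/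
theorem reduced_gate (W : ι → Matrix γ β ℂ) (hW : ∀ s, (W s)ᴴ * W s = 1) (v : (ι → β) → ℂ)
    (T : Finset ι) :
    reduced T (density (gate W v)) = tensor (fun s : {s // s ∈ T} => W s) *
      reduced T (density v) * (tensor (fun s : {s // s ∈ T} => W s))ᴴ := by
  have h := tensor_isometry (fun s : {s // s ∉ T} => W s) fun s => hW s
  set K := tensor (fun s : {s // s ∈ T} => W s)
  set N := tensor (fun s : {s // s ∉ T} => W s)
  have h' : Nᵀ * Nᵀᴴ = 1 := by
    have := congrArg Matrix.transpose h
    rwa [Matrix.transpose_mul, Matrix.transpose_one] at this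
  rw [reduced_density_eq, reduced_density_eq, bipartite_gate, Matrix.conjTranspose_mul,
    Matrix.conjTranspose_mul]
  calc _ = K * bipartite T v * (Nᵀ * Nᵀᴴ) * ((bipartite T v)ᴴ * Kᴴ) := by
        simp only [Matrix.mul_assoc]; rfl
    _ = _ := by rw [h', Matrix.mul_one]; simp only [Matrix.mul_assoc]

theorem setEntropy_gate (W : ι → Matrix γ β ℂ) (hW : ∀ s, (W s)ᴴ * W s = 1) (v : (ι → β) → ℂ)
    (T : Finset ι) : setEntropy T (gate W v) = setEntropy T v := by
  rw [setEntropy, reduced_gate W hW, specEntropy_conj_isometry _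
    (tensor_isometry (fun s : {s // s ∈ T} => W s) fun s => hW s), setEntropy]

theorem norm_gate (W : ι → Matrix γ β ℂ) (hW : ∀ s, (W s)ᴴ * W s = 1) (v : (ι → β) → ℂ) :
    ∑ z, gate W v z * conj (gate W v z) = ∑ x, v x * conj (v x) := by
  rw [← trace_reduced_density ∅, ← trace_reduced_density ∅, reduced_gate W hW,
    Matrix.trace_mul_comm, ← Matrix.mul_assoc, tensor_isometry
      (fun s : {s // s ∈ (∅ : Finset ι)} => W s) fun s => hW s, Matrix.one_mul]

/-- Grouping the sites into pairs. -/
def pairUp (e : ι ⊕ ι ≃ τ) : (τ → α) ≃ (ι → α × α) where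
  toFun y s := (y (e (Sum.inl s)), y (e (Sum.inr s)))
  invFun x t := Sum.elim (fun s => (x s).1) (fun s => (x s).2) (e.symm t)
  left_inv y := by
    ext t
    obtain ⟨t, rfl⟩ := e.surjective t
    rcases t with t | t <;> simp
  right_inv x := by
    ext s <;> simp

theorem norm_comp_pairUp (e : ι ⊕ ι ≃ τ) (u : (ι → α × α) → ℂ) :
    ∑ y, (u ∘ pairUp e) y * conj ((u ∘ pairUp e) y) = ∑ x, u x * conj (u x) :=
  (pairUp e).sum_comp fun x => u x * conj (u x)

/-- The hypotheses say that `A` is the union of the pairs in `T`; grouping then only relabels rows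
and columns of the amplitude matrix. -/
theorem setEntropy_comp_pairUp (e : ι ⊕ ι ≃ τ) (u : (ι → α × α) → ℂ) {A : Finset τ}
    {T : Finset ι} (hl : ∀ s, e (Sum.inl s) ∈ A ↔ s ∈ T) (hr : ∀ s, e (Sum.inr s) ∈ A ↔ s ∈ T) :
    setEntropy A (u ∘ pairUp e) = setEntropy T u := by
  have key : ∀ (p : τ → Prop) (q : ι → Prop) (_ : ∀ s, p (e (Sum.inl s)) ↔ q s)
      (_ : ∀ s, p (e (Sum.inr s)) ↔ q s), ∃ f : ({t // p t} → α) ≃ ({s // q s} → α × α),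
      ∀ x s, f x s = (x ⟨e (Sum.inl s.1), by simp [*, s.2]⟩,
        x ⟨e (Sum.inr s.1), by simp [*, s.2]⟩) := by
    intro p q h1 h2
    refine ⟨Equiv.ofBijective (fun x s => (x ⟨e (Sum.inl s.1), (h1 _).mpr s.2⟩,
      x ⟨e (Sum.inr s.1), (h2 _).mpr s.2⟩)) ⟨?_, ?_⟩, fun x s => rfl⟩
    · intro x x' h
      ext ⟨t, ht⟩
      obtain ⟨t, rfl⟩ := e.surjective t
      rcases t with t | t
      · exact congrArg Prod.fst (congrFun h ⟨t, (h1 t).mp ht⟩)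
      · exact congrArg Prod.snd (congrFun h ⟨t, (h2 t).mp ht⟩)
    · intro y
      refine ⟨fun t => match h : e.symm t.1 with
        | Sum.inl s => (y ⟨s, (h1 s).mp (by rw [← h]; simpa using t.2)⟩).1
        | Sum.inr s => (y ⟨s, (h2 s).mp (by rw [← h]; simpa using t.2)⟩).2, ?_⟩
      ext s
      · dsimp only
        split
        · next s' h =>
          simp only [Equiv.symm_apply_apply, Sum.inl.injEq] at h
          subst h; rfl
        · next s' h => simp at h
      · dsimp only
        split
        · next s' h => simp at h
        · next s' h =>
          simp only [Equiv.symm_apply_apply, Sum.inr.injEq] at h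
          subst h; rfl
  obtain ⟨f, hf⟩ := key (· ∈ A) (· ∈ T) hl hr
  obtain ⟨g, hg⟩ := key (· ∉ A) (· ∉ T) (fun s => not_congr (hl s)) (fun s => not_congr (hr s))
  have h : bipartite A (u ∘ pairUp e) = (bipartite T u).submatrix f g := by
    ext x z
    simp only [bipartite, Matrix.submatrix_apply, Function.comp]
    congr 1
    ext1 s
    simp only [pairUp, Equiv.coe_fn_mk, joinConfig_apply, hl, hr]
    by_cases hs : s ∈ T
    · simp [hs, hf]
    · simp [hs, hg]
  rw [setEntropy, setEntropy, reduced_density_eq, reduced_density_eq, h,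
    Matrix.conjTranspose_submatrix, Matrix.submatrix_mul_equiv, specEntropy_submatrix]

end Gates

end RandomMERA

namespace RandomMERA

open Matrix Finset
open scoped ComplexConjugate ComplexOrder

set_option linter.unusedSectionVars false

/-! ## Purities -/

section Purity

variable {ι τ α β : Type} [Fintype ι] [DecidableEq ι] [Fintype τ] [DecidableEq τ]
  [Fintype α] [DecidableEq α] [Fintype β] [DecidableEq β]

/-- The purity `tr ρ_A ^ 2` of a pure state, as the expectation of the swap of `A` between two
copies. -/
def purity (A : Finset ι) (v : (ι → α) → ℂ) : ℂ :=
  ∑ x : ι → α, ∑ x' : ι → α,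
    v x * v x' * conj (v (A.piecewise x' x)) * conj (v (A.piecewise x x'))

theorem purity_eq_trace (A : Finset ι) (v : (ι → α) → ℂ) :
    purity A v = ((reduced A (density v)) ^ 2).trace := by
  have hp : ∀ (x x' : {s // s ∈ A} → α) (z z' : {s // s ∉ A} → α),
      A.piecewise (joinConfig A x z) (joinConfig A x' z') = joinConfig A x z' := by
    intro x x' z z'
    ext s
    by_cases hs : s ∈ A <;> simp [Finset.piecewise, hs]
  unfold purity
  rw [← (Equiv.piEquivPiSubtypeProd (· ∈ A) fun _ => α).symm.sum_comp]
  simp_rw [← (Equiv.piEquivPiSubtypeProd (· ∈ A) fun _ => α).symm.sum_comp]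
  simp only [Fintype.sum_prod_type, hp, sq, Matrix.trace, Matrix.diag, Matrix.mul_apply, reduced,
    density, Matrix.vecMulVec_apply, Pi.star_apply, RCLike.star_def, Finset.sum_mul_sum]
  refine Finset.sum_congr rfl fun x _ => ?_
  rw [Finset.sum_comm]
  refine Finset.sum_congr rfl fun x' _ => Finset.sum_congr rfl fun z _ =>
    Finset.sum_congr rfl fun z' _ => ?_
  ring

theorem purity_re_le_one (A : Finset ι) {v : (ι → α) → ℂ} (hv : ∑ y, v y * conj (v y) = 1) :
    (purity A v).re ≤ 1 := by
  rw [purity_eq_trace]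
  exact trace_sq_re_le_one (posSemidef_reduced_density A v) ((trace_reduced_density A v).trans hv)

theorem purity_re_nonneg (A : Finset ι) (v : (ι → α) → ℂ) : 0 ≤ (purity A v).re := by
  rw [purity_eq_trace, trace_pow_eq_sum_eigenvalues (posSemidef_reduced_density A v).1,
    Complex.ofReal_re]
  positivity

theorem purity_im (A : Finset ι) (v : (ι → α) → ℂ) : (purity A v).im = 0 := by
  rw [purity_eq_trace, trace_pow_eq_sum_eigenvalues (posSemidef_reduced_density A v).1,
    Complex.ofReal_im]

theorem norm_purity_le_one (A : Finset ι) {v : (ι → α) → ℂ} (hv : ∑ y, v y * conj (v y) = 1) :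
    ‖purity A v‖ ≤ 1 := by
  have h : purity A v = ((purity A v).re : ℂ) := Complex.ext rfl (purity_im A v)
  rw [h, Complex.norm_real, Real.norm_of_nonneg (purity_re_nonneg A v)]
  exact purity_re_le_one A hv

/-- Here `A` may cut pairs, so the two members of a pair are swapped independently. -/
theorem purity_comp_pairUp (e : ι ⊕ ι ≃ τ) (u : (ι → α × α) → ℂ) (A : Finset τ) :
    purity A (u ∘ pairUp e) = ∑ z, ∑ z', u z * u z' *
      conj (u fun s => (if e (Sum.inl s) ∈ A then (z' s).1 else (z s).1,
        if e (Sum.inr s) ∈ A then (z' s).2 else (z s).2)) *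
      conj (u fun s => (if e (Sum.inl s) ∈ A then (z s).1 else (z' s).1,
        if e (Sum.inr s) ∈ A then (z s).2 else (z' s).2)) := by
  unfold purity
  rw [← (pairUp e).sum_comp]
  refine Finset.sum_congr rfl fun x _ => ?_
  rw [← (pairUp e).sum_comp]
  rfl

theorem purity_comp_pairUp_of_mem (e : ι ⊕ ι ≃ τ) (u : (ι → α × α) → ℂ) {A : Finset τ}
    {T : Finset ι} (hl : ∀ s, e (Sum.inl s) ∈ A ↔ s ∈ T) (hr : ∀ s, e (Sum.inr s) ∈ A ↔ s ∈ T) :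
    purity A (u ∘ pairUp e) = purity T u := by
  rw [purity_comp_pairUp]
  unfold purity
  have h : ∀ z z' : ι → α × α, (fun s => (if e (Sum.inl s) ∈ A then (z' s).1 else (z s).1,
        if e (Sum.inr s) ∈ A then (z' s).2 else (z s).2)) = T.piecewise z' z := by
    intro z z'
    ext1 s
    by_cases hs : s ∈ T <;> simp [hl, hr, hs, Finset.piecewise]
  simp only [h]

/-- The weight of the swap after averaging over a Haar isometry, depending on whether the first and
the second output are swapped. -/
noncomputable def swapCoeff (d : ℕ) (p q : Prop) [Decidable p] [Decidable q] : ℝ :=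
  if p ∧ q then 1 else if p ∨ q then (d : ℝ) / ((d : ℝ) ^ 2 + 1) else 0

theorem swapCoeff_nonneg (d : ℕ) (p q : Prop) [Decidable p] [Decidable q] :
    0 ≤ swapCoeff d p q := by
  unfold swapCoeff
  split_ifs <;> positivity

/-- Only the swap and the identity survive on the input. Exchanging the two copies in the conjugated
factors interchanges them and negates `p` and `q`, which is why the identity has the weight with
negated arguments. -/
theorem sum_haarMoment_swaps {d : ℕ} (hd : 0 < d) [Nonempty (IsometryMatrix (Fin d × Fin d) β)]
    (p q : Prop) [Decidable p] [Decidable q] (a b c e : β) :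
    ∑ z : Fin d × Fin d, ∑ z' : Fin d × Fin d, haarMoment a b c e z z'
        (if p then z'.1 else z.1, if q then z'.2 else z.2)
        (if p then z.1 else z'.1, if q then z.2 else z'.2) =
      (swapCoeff d p q : ℂ) * (if a = e ∧ b = c then 1 else 0) +
        (swapCoeff d (¬ p) (¬ q) : ℂ) * (if a = c ∧ b = e then 1 else 0) := by
  have e0 : ∀ p q : Prop, [Decidable p] → [Decidable q] → (if p ∧ q then (1 : ℂ) else 0) =
      (if p then 1 else 0) * (if q then 1 else 0) := by
    intro p q _ _
    by_cases p <;> by_cases q <;> simp [*]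
  rw [e0, e0]
  by_cases hp : p <;> by_cases hq : q
  · simp only [hp, hq, if_true, swapCoeff]
    rw [sum_haarMoment_swap]
    simp
  · simp only [hp, hq, if_true, if_false, swapCoeff, and_false, false_and, or_false, false_or,
      not_true_eq_false, not_false_eq_true]
    rw [sum_haarMoment_halfSwap_left hd]
    ring
  · simp only [hp, hq, if_true, if_false, swapCoeff, and_false, false_and, or_false, false_or,
      not_true_eq_false, not_false_eq_true]
    rw [sum_haarMoment_halfSwap_right hd]
    ring
  · simp only [hp, hq, if_false, swapCoeff]
    rw [sum_haarMoment_id]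
    simp

theorem sum_sum_prod_eq₂ {κ R : Type} [Fintype κ] [DecidableEq κ] [CommSemiring R]
    (f : ι → κ → κ → R) :
    ∑ z : ι → κ, ∑ z' : ι → κ, ∏ s, f s (z s) (z' s) = ∏ s, ∑ a, ∑ a', f s a a' := by
  rw [← sum_sum_prod_eq fun s a => ∑ a', f s a a']
  refine Finset.sum_congr rfl fun z _ => ?_
  rw [← sum_sum_prod_eq fun s a' => f s (z s) a']

theorem sum_comm_four {κ X R : Type} [Fintype κ] [Fintype X] [AddCommMonoid R]
    (F : κ → X → X → X → X → R) :
    ∑ k, ∑ x, ∑ x', ∑ y, ∑ y', F k x x' y y' = ∑ x, ∑ x', ∑ y, ∑ y', ∑ k, F k x x' y y' := by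
  rw [Finset.sum_comm]
  refine Finset.sum_congr rfl fun x _ => ?_
  rw [Finset.sum_comm]
  refine Finset.sum_congr rfl fun x' _ => ?_
  rw [Finset.sum_comm]
  exact Finset.sum_congr rfl fun y _ => Finset.sum_comm

/-- Expanding the product, `T` is the set of gates at which the swap term is chosen. The indicators
then force `y, y'` to be `x, x'` exchanged on `T`. -/
theorem prod_mul_add_mul_indicator (c c' : ι → ℂ) (x x' y y' : ι → β) :
    ∏ s, (c s * (if x s = y' s ∧ x' s = y s then 1 else 0) +
      c' s * (if x s = y s ∧ x' s = y' s then 1 else 0)) =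
    ∑ T : Finset ι, ((∏ s ∈ T, c s) * ∏ s ∈ Tᶜ, c' s) *
      if y = T.piecewise x' x ∧ y' = T.piecewise x x' then 1 else 0 := by
  rw [Finset.prod_add, Finset.powerset_univ]
  refine Finset.sum_congr rfl fun T _ => ?_
  rw [Finset.prod_mul_distrib, Finset.prod_mul_distrib, Finset.prod_ite_zero, Finset.prod_ite_zero,
    ← Finset.compl_eq_univ_sdiff, mul_mul_mul_comm]
  congr 1
  simp only [Finset.prod_const_one]
  have : (y = T.piecewise x' x ∧ y' = T.piecewise x x') ↔
      (∀ s ∈ T, x s = y' s ∧ x' s = y s) ∧ ∀ s ∈ Tᶜ, x s = y s ∧ x' s = y' s := by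
    simp only [funext_iff, Finset.piecewise, Finset.mem_compl]
    constructor
    · rintro ⟨h1, h2⟩
      refine ⟨fun s hs => ?_, fun s hs => ?_⟩
      · have a := h1 s; have b := h2 s; simp only [hs, if_true] at a b; exact ⟨b.symm, a.symm⟩
      · have a := h1 s; have b := h2 s; simp only [hs, if_false] at a b; exact ⟨a.symm, b.symm⟩
    · rintro ⟨h1, h2⟩
      refine ⟨fun s => ?_, fun s => ?_⟩ <;> by_cases hs : s ∈ T <;>
        simp only [hs, if_true, if_false]
      exacts [(h1 s hs).2.symm, (h2 s hs).1.symm, (h1 s hs).1.symm, (h2 s hs).2.symm]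
  rw [if_congr this rfl rfl]
  have e0 : ∀ p q : Prop, ∀ [Decidable p] [Decidable q] [Decidable (p ∧ q)],
      (if p then (1 : ℂ) else 0) * (if q then 1 else 0) = if p ∧ q then 1 else 0 := by
    intro p q _ _ _
    by_cases p <;> by_cases q <;> simp [*]
  exact e0 _ _

/-- The average purity after a layer of independent Haar isometries. -/
theorem integral_purity_gate {d : ℕ} (hd : 0 < d) [Nonempty (IsometryMatrix (Fin d × Fin d) β)]
    (e : ι ⊕ ι ≃ τ) (A : Finset τ) (v : (ι → β) → ℂ) :
    ∫ W : ι → IsometryMatrix (Fin d × Fin d) β,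
        purity A (gate (fun s => (W s).1) v ∘ pairUp e) ∂(Measure.pi fun _ => haarIsometry _ _) =
      ∑ T : Finset ι, ((∏ s ∈ T, (swapCoeff d (e (Sum.inl s) ∈ A) (e (Sum.inr s) ∈ A) : ℂ)) *
        ∏ s ∈ Tᶜ, (swapCoeff d (e (Sum.inl s) ∉ A) (e (Sum.inr s) ∉ A) : ℂ)) * purity T v := by
  set w : (ι → Fin d × Fin d) → (ι → Fin d × Fin d) → ι → Fin d × Fin d := fun z z' s =>
    (if e (Sum.inl s) ∈ A then (z' s).1 else (z s).1,
      if e (Sum.inr s) ∈ A then (z' s).2 else (z s).2) with hw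
  set w' : (ι → Fin d × Fin d) → (ι → Fin d × Fin d) → ι → Fin d × Fin d := fun z z' s =>
    (if e (Sum.inl s) ∈ A then (z s).1 else (z' s).1,
      if e (Sum.inr s) ∈ A then (z s).2 else (z' s).2) with hw'
  set V : (ι → β) → (ι → β) → (ι → β) → (ι → β) → ℂ := fun x x' y y' =>
    v x * v x' * conj (v y) * conj (v y') with hV
  have hexp : ∀ W : ι → IsometryMatrix (Fin d × Fin d) β,
      purity A (gate (fun s => (W s).1) v ∘ pairUp e) =
        ∑ z, ∑ z', ∑ x, ∑ x', ∑ y, ∑ y', V x x' y y' *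
          ∏ s, monomial22 (x s) (x' s) (y s) (y' s) (z s) (z' s) (w z z' s) (w' z z' s) (W s) := by
    intro W
    rw [purity_comp_pairUp]
    refine Finset.sum_congr rfl fun z _ => Finset.sum_congr rfl fun z' _ => ?_
    simp only [gate, map_sum, map_mul, map_prod]
    simp only [mul_comm (∏ s, _)]
    have := sum_mul_sum_mul_sum_mul_sum v v (fun y => conj (v y)) (fun y => conj (v y))
      (fun x => ∏ s, (W s).1 (z s) (x s)) (fun x => ∏ s, (W s).1 (z' s) (x s))
      (fun x => ∏ s, conj ((W s).1 (w z z' s) (x s)))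
      (fun x => ∏ s, conj ((W s).1 (w' z z' s) (x s)))
    refine this.trans ?_
    simp only [Finset.mul_sum, monomial22, Finset.prod_mul_distrib, hV]
    refine Finset.sum_congr rfl fun x _ => Finset.sum_congr rfl fun x' _ =>
      Finset.sum_congr rfl fun y _ => Finset.sum_congr rfl fun y' _ => ?_
    ring
  have hint : ∀ x x' y y' : ι → β, ∀ z z' u u' : ι → Fin d × Fin d,
      Integrable (fun W : ι → IsometryMatrix (Fin d × Fin d) β =>
        ∏ s, monomial22 (x s) (x' s) (y s) (y' s) (z s) (z' s) (u s) (u' s) (W s))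
        (Measure.pi fun _ => haarIsometry _ _) := by
    intro x x' y y' z z' u u'
    exact Integrable.fintype_prod fun s => integrable_monomial22 _ _ _ _ _ _ _ _
  simp only [hexp]
  have h1 : ∫ W : ι → IsometryMatrix (Fin d × Fin d) β, (∑ z, ∑ z', ∑ x, ∑ x', ∑ y, ∑ y',
      V x x' y y' * ∏ s, monomial22 (x s) (x' s) (y s) (y' s) (z s) (z' s) (w z z' s) (w' z z' s)
        (W s)) ∂(Measure.pi fun _ => haarIsometry _ _) =
      ∑ z, ∑ z', ∑ x, ∑ x', ∑ y, ∑ y', V x x' y y' *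
        ∏ s, haarMoment (x s) (x' s) (y s) (y' s) (z s) (z' s) (w z z' s) (w' z z' s) := by
    -- The nested sums are flattened into one, so that linearity is applied once. Independence of
    -- the gates then factors each integral into moments.
    simp only [← Fintype.sum_prod_type']
    rw [integral_finsetSum _ fun i _ => ?_]
    · refine Finset.sum_congr rfl fun i _ => ?_
      rw [integral_const_mul, integral_fintype_prod_eq_prod]
      rfl
    · exact (hint _ _ _ _ _ _ _ _).const_mul _
  rw [h1]
  -- For fixed inputs, the sum over the outputs factors over the gates.
  have h2 : ∀ x x' y y' : ι → β, ∑ z, ∑ z',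
      ∏ s, haarMoment (x s) (x' s) (y s) (y' s) (z s) (z' s) (w z z' s) (w' z z' s) =
      ∑ T : Finset ι, ((∏ s ∈ T, (swapCoeff d (e (Sum.inl s) ∈ A) (e (Sum.inr s) ∈ A) : ℂ)) *
        ∏ s ∈ Tᶜ, (swapCoeff d (e (Sum.inl s) ∉ A) (e (Sum.inr s) ∉ A) : ℂ)) *
        if y = T.piecewise x' x ∧ y' = T.piecewise x x' then 1 else 0 := by
    intro x x' y y'
    rw [← prod_mul_add_mul_indicator, sum_sum_prod_eq₂ fun s a a' =>
      haarMoment (x s) (x' s) (y s) (y' s) a a'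
        (if e (Sum.inl s) ∈ A then a'.1 else a.1, if e (Sum.inr s) ∈ A then a'.2 else a.2)
        (if e (Sum.inl s) ∈ A then a.1 else a'.1, if e (Sum.inr s) ∈ A then a.2 else a'.2)]
    exact Finset.prod_congr rfl fun s _ => sum_haarMoment_swaps hd _ _ _ _ _ _
  calc _ = ∑ x, ∑ x', ∑ y, ∑ y', V x x' y y' * ∑ z, ∑ z',
        ∏ s, haarMoment (x s) (x' s) (y s) (y' s) (z s) (z' s) (w z z' s) (w' z z' s) := by
        simp only [Finset.mul_sum]
        refine (Finset.sum_congr rfl fun z _ => sum_comm_four _).trans (sum_comm_four _)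
    _ = ∑ T : Finset ι, ∑ x, ∑ x', ∑ y, ∑ y', V x x' y y' *
        (((∏ s ∈ T, (swapCoeff d (e (Sum.inl s) ∈ A) (e (Sum.inr s) ∈ A) : ℂ)) *
        ∏ s ∈ Tᶜ, (swapCoeff d (e (Sum.inl s) ∉ A) (e (Sum.inr s) ∉ A) : ℂ)) *
        if y = T.piecewise x' x ∧ y' = T.piecewise x x' then 1 else 0) := by
        simp only [h2]
        rw [sum_comm_four]
        simp only [Finset.mul_sum]
    _ = _ := by
        refine Finset.sum_congr rfl fun T _ => ?_
        unfold purity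
        simp only [Finset.mul_sum]
        refine Finset.sum_congr rfl fun x _ => Finset.sum_congr rfl fun x' _ => ?_
        rw [Finset.sum_eq_single (T.piecewise x' x), Finset.sum_eq_single (T.piecewise x x')]
        · simp only [hV, and_self, if_true]
          ring
        · intro y' _ hy'
          simp [hy']
        · simp
        · intro y _ hy
          simp [hy]
        · simp

end Purity

end RandomMERA

namespace RandomMERA

open Finset

/-! ## Intervals of sites -/

theorem intCast_zmod_two_pow_eq_iff (k : ℕ) (t u : ℤ) :
    (t : ZMod (2 ^ k)) = (u : ZMod (2 ^ k)) ↔ ∃ q : ℤ, u = t + 2 ^ k * q := by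
  rw [ZMod.intCast_eq_intCast_iff_dvd_sub]
  push_cast
  constructor
  · rintro ⟨q, hq⟩; exact ⟨q, by linarith⟩
  · rintro ⟨q, hq⟩; exact ⟨q, by linarith⟩

theorem intCast_mem_intervalSites (k : ℕ) (i j t : ℤ) :
    (t : ZMod (2 ^ k)) ∈ intervalSites k i j ↔ ∃ q : ℤ, i ≤ t + 2 ^ k * q ∧ t + 2 ^ k * q ≤ j := by
  simp only [intervalSites, Finset.mem_image, Finset.mem_Icc]
  constructor
  · rintro ⟨u, hu, h⟩
    obtain ⟨q, rfl⟩ := (intCast_zmod_two_pow_eq_iff k t u).mp h.symm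
    exact ⟨q, hu⟩
  · rintro ⟨q, hq⟩
    exact ⟨_, hq, ((intCast_zmod_two_pow_eq_iff k t _).mpr ⟨q, rfl⟩).symm⟩

theorem exists_intCast_eq {k : ℕ} (s : ZMod (2 ^ k)) : ∃ t : ℤ, (t : ZMod (2 ^ k)) = s :=
  ZMod.intCast_surjective s

/-- The position at level `k + 1` of a member of a pair with index `s`, for a given offset. -/
def pairSite (k p : ℕ) (s : ZMod (2 ^ k)) : ZMod (2 ^ (k + 1)) := ((2 * s.val + p : ℕ) : ZMod _)

/-- Doubling carries the period `2 ^ k` to `2 ^ (k + 1)`, so any integer representative may replace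
`val`, and intervals can be treated by integer arithmetic. The offset `p` is `0` for layers `V` and
`1` for layers `W`. -/
theorem pairSite_intCast (k p : ℕ) (t : ℤ) :
    pairSite k p (t : ZMod (2 ^ k)) = ((2 * t + p : ℤ) : ZMod (2 ^ (k + 1))) := by
  have h : (((t : ZMod (2 ^ k)).val : ℤ) : ZMod (2 ^ k)) = (t : ZMod (2 ^ k)) := by
    simp
  obtain ⟨q, hq⟩ := (intCast_zmod_two_pow_eq_iff k _ _).mp h
  have e : pairSite k p (t : ZMod (2 ^ k)) =
      ((2 * ((t : ZMod (2 ^ k)).val : ℤ) + p : ℤ) : ZMod (2 ^ (k + 1))) := by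
    simp [pairSite]
  rw [e, intCast_zmod_two_pow_eq_iff]
  refine ⟨q, ?_⟩
  rw [pow_succ]
  linear_combination 2 * hq

/-- Each site belongs to exactly one of the pairs `2s + p, 2s + 1 + p`. -/
noncomputable def pairEquiv (k p : ℕ) : ZMod (2 ^ k) ⊕ ZMod (2 ^ k) ≃ ZMod (2 ^ (k + 1)) :=
  Equiv.ofBijective (Sum.elim (pairSite k p) (pairSite k (p + 1))) <| by
    have hinj : ∀ t u : ℤ, ∀ r r' : ℤ, 0 ≤ r → r ≤ 1 → 0 ≤ r' → r' ≤ 1 →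
        ((2 * t + (p + r) : ℤ) : ZMod (2 ^ (k + 1))) = ((2 * u + (p + r') : ℤ) : ZMod _) →
        r = r' ∧ (t : ZMod (2 ^ k)) = (u : ZMod (2 ^ k)) := by
      intro t u r r' _ _ _ _ h
      obtain ⟨q, hq⟩ := (intCast_zmod_two_pow_eq_iff _ _ _).mp h
      rw [pow_succ, mul_comm _ (2 : ℤ), mul_assoc] at hq
      refine ⟨by omega, (intCast_zmod_two_pow_eq_iff _ _ _).mpr ⟨q, by omega⟩⟩
    rw [Fintype.bijective_iff_injective_and_card]
    constructor
    · intro x y h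
      rcases x with s | s <;> rcases y with s' | s' <;> obtain ⟨t, rfl⟩ := exists_intCast_eq s <;>
        obtain ⟨u, rfl⟩ := exists_intCast_eq s' <;>
        simp only [Sum.elim_inl, Sum.elim_inr, pairSite_intCast] at h
      · rw [(hinj t u 0 0 le_rfl zero_le_one le_rfl zero_le_one (by simpa using h)).2]
      · have := (hinj t u 0 1 le_rfl zero_le_one zero_le_one le_rfl (by simpa using h)).1
        omega
      · have := (hinj t u 1 0 zero_le_one le_rfl le_rfl zero_le_one (by simpa using h)).1
        omega
      · rw [(hinj t u 1 1 zero_le_one le_rfl zero_le_one le_rfl (by simpa using h)).2]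
    · simp [ZMod.card, pow_succ]
      ring

theorem pairEquiv_inl (k p : ℕ) (s : ZMod (2 ^ k)) :
    pairEquiv k p (Sum.inl s) = pairSite k p s := rfl

theorem pairEquiv_inr (k p : ℕ) (s : ZMod (2 ^ k)) :
    pairEquiv k p (Sum.inr s) = pairSite k (p + 1) s := rfl

theorem pairSite_mem_intervalSites (k p r : ℕ) (hr : r ≤ 1) (a b : ℤ) (s : ZMod (2 ^ k)) :
    pairSite k (p + r) s ∈ intervalSites (k + 1) (2 * a + p) (2 * b + 1 + p) ↔
      s ∈ intervalSites k a b := by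
  obtain ⟨t, rfl⟩ := exists_intCast_eq s
  rw [pairSite_intCast, intCast_mem_intervalSites, intCast_mem_intervalSites]
  refine exists_congr fun q => ?_
  rw [pow_succ, mul_comm _ (2 : ℤ), mul_assoc]
  push_cast
  omega

theorem pairEquiv_inl_mem (k p : ℕ) (a b : ℤ) (s : ZMod (2 ^ k)) :
    pairEquiv k p (Sum.inl s) ∈ intervalSites (k + 1) (2 * a + p) (2 * b + 1 + p) ↔
      s ∈ intervalSites k a b :=
  pairSite_mem_intervalSites k p 0 zero_le_one a b s

theorem pairEquiv_inr_mem (k p : ℕ) (a b : ℤ) (s : ZMod (2 ^ k)) :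
    pairEquiv k p (Sum.inr s) ∈ intervalSites (k + 1) (2 * a + p) (2 * b + 1 + p) ↔
      s ∈ intervalSites k a b :=
  pairSite_mem_intervalSites k p 1 le_rfl a b s

theorem swapCoeff_le_one (d : ℕ) (p q : Prop) [Decidable p] [Decidable q] :
    swapCoeff d p q ≤ 1 := by
  unfold swapCoeff
  split_ifs
  · exact le_rfl
  · rw [div_le_one (by positivity)]
    nlinarith [sq_nonneg ((d : ℝ) - 1)]
  · exact zero_le_one

theorem swapCoeff_le_inv {d : ℕ} (hd : 0 < d) {p q : Prop} [Decidable p] [Decidable q]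
    (h : ¬ (p ∧ q)) : swapCoeff d p q ≤ (d : ℝ)⁻¹ := by
  have hd' : (0 : ℝ) < d := by exact_mod_cast hd
  unfold swapCoeff
  split_ifs
  · rw [inv_eq_one_div, div_le_div_iff₀ (by positivity) hd']
    nlinarith
  · positivity

/-- The weight of the set of pairs `T` in the average purity of the set of sites `A`. -/
noncomputable def pairWeight (k p d : ℕ) (A : Finset (ZMod (2 ^ (k + 1))))
    (T : Finset (ZMod (2 ^ k))) : ℝ :=
  (∏ s ∈ T, swapCoeff d (pairEquiv k p (Sum.inl s) ∈ A) (pairEquiv k p (Sum.inr s) ∈ A)) *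
    ∏ s ∈ Tᶜ, swapCoeff d (pairEquiv k p (Sum.inl s) ∉ A) (pairEquiv k p (Sum.inr s) ∉ A)

theorem pairWeight_nonneg (k p d : ℕ) (A : Finset (ZMod (2 ^ (k + 1))))
    (T : Finset (ZMod (2 ^ k))) : 0 ≤ pairWeight k p d A T :=
  mul_nonneg (Finset.prod_nonneg fun _ _ => swapCoeff_nonneg _ _ _)
    (Finset.prod_nonneg fun _ _ => swapCoeff_nonneg _ _ _)

/-- Each pair in `S` is cut by `A` and contributes a factor at most `1 / d`, whether or not it
belongs to `T`; all other factors are at most one. -/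
theorem pairWeight_le_pow {k p d : ℕ} (hd : 0 < d) (A : Finset (ZMod (2 ^ (k + 1))))
    (T S : Finset (ZMod (2 ^ k)))
    (hS : ∀ s ∈ S, ¬ (pairEquiv k p (Sum.inl s) ∈ A ↔ pairEquiv k p (Sum.inr s) ∈ A)) :
    pairWeight k p d A T ≤ (d : ℝ)⁻¹ ^ S.card := by
  have h : (d : ℝ)⁻¹ ^ S.card = (∏ s ∈ T, if s ∈ S then (d : ℝ)⁻¹ else 1) *
      ∏ s ∈ Tᶜ, if s ∈ S then (d : ℝ)⁻¹ else 1 := by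
    rw [Finset.prod_mul_prod_compl, Finset.prod_ite_mem, Finset.univ_inter, Finset.prod_const]
  rw [h, pairWeight]
  refine mul_le_mul (Finset.prod_le_prod (fun _ _ => swapCoeff_nonneg _ _ _) fun s _ => ?_)
    (Finset.prod_le_prod (fun _ _ => swapCoeff_nonneg _ _ _) fun s _ => ?_)
    (Finset.prod_nonneg fun _ _ => swapCoeff_nonneg _ _ _)
    (Finset.prod_nonneg fun _ _ => by split_ifs <;> positivity)
  · split_ifs with hs
    · exact swapCoeff_le_inv hd fun h => hS s hs (iff_of_true h.1 h.2)
    · exact swapCoeff_le_one _ _ _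
  · split_ifs with hs
    · exact swapCoeff_le_inv hd fun h => hS s hs (iff_of_false h.1 h.2)
    · exact swapCoeff_le_one _ _ _

/-- A contributing `T` contains the pairs inside `A` and avoids those outside; only cut pairs are
free. -/
theorem pairWeight_ne_zero {k p d : ℕ} {A : Finset (ZMod (2 ^ (k + 1)))}
    {T : Finset (ZMod (2 ^ k))} (h : pairWeight k p d A T ≠ 0) (s : ZMod (2 ^ k)) :
    (s ∈ T → pairEquiv k p (Sum.inl s) ∈ A ∨ pairEquiv k p (Sum.inr s) ∈ A) ∧
    (pairEquiv k p (Sum.inl s) ∈ A → pairEquiv k p (Sum.inr s) ∈ A → s ∈ T) := by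
  rw [pairWeight, mul_ne_zero_iff, Finset.prod_ne_zero_iff, Finset.prod_ne_zero_iff] at h
  constructor
  · intro hs
    by_contra! hc
    exact h.1 s hs (by simp [swapCoeff, hc])
  · intro h1 h2
    by_contra hs
    exact h.2 s (Finset.mem_compl.mpr hs) (by simp [swapCoeff, h1, h2])

/-! ### Intervals made of the pairs `a, …, b`, with `δ` and `δ'` sites missing at the ends -/

section Interval

variable {k p : ℕ} {a b : ℤ} {δ δ' : ℕ}

/-- A pair that meets a proper interval is one of those between the first and the last pair. -/
theorem mem_of_pair_meets (hδ : δ ≤ 1) (hδ' : δ' ≤ 1) {s : ZMod (2 ^ k)}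
    (h : pairEquiv k p (Sum.inl s) ∈ intervalSites (k + 1) (2 * a + p + δ) (2 * b + p + 1 - δ') ∨
      pairEquiv k p (Sum.inr s) ∈ intervalSites (k + 1) (2 * a + p + δ) (2 * b + p + 1 - δ')) :
    ∃ t : ℤ, (t : ZMod (2 ^ k)) = s ∧ a ≤ t ∧ t ≤ b := by
  obtain ⟨t, rfl⟩ := exists_intCast_eq s
  rw [pairEquiv_inl, pairEquiv_inr, pairSite_intCast, pairSite_intCast, intCast_mem_intervalSites,
    intCast_mem_intervalSites] at h
  simp only [pow_succ, mul_comm _ (2 : ℤ), mul_assoc] at h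
  rcases h with ⟨q, h1, h2⟩ | ⟨q, h1, h2⟩
  · exact ⟨t + 2 ^ k * q, ((intCast_zmod_two_pow_eq_iff _ _ _).mpr ⟨q, rfl⟩).symm, by omega,
      by omega⟩
  · push_cast at h1 h2
    exact ⟨t + 2 ^ k * q, ((intCast_zmod_two_pow_eq_iff _ _ _).mpr ⟨q, rfl⟩).symm, by omega,
      by omega⟩

theorem pair_mem_of_le {t : ℤ} (h1 : a + δ ≤ t) (h2 : t ≤ b - δ') (hδ : δ ≤ 1) (hδ' : δ' ≤ 1) :
    pairEquiv k p (Sum.inl (t : ZMod (2 ^ k))) ∈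
        intervalSites (k + 1) (2 * a + p + δ) (2 * b + p + 1 - δ') ∧
      pairEquiv k p (Sum.inr (t : ZMod (2 ^ k))) ∈
        intervalSites (k + 1) (2 * a + p + δ) (2 * b + p + 1 - δ') := by
  rw [pairEquiv_inl, pairEquiv_inr, pairSite_intCast, pairSite_intCast, intCast_mem_intervalSites,
    intCast_mem_intervalSites]
  constructor
  · exact ⟨0, by omega, by omega⟩
  · exact ⟨0, by push_cast; omega, by push_cast; omega⟩

/-- The sets of pairs that contribute to the average purity of an interval are intervals. -/
theorem exists_interval_of_pairWeight_ne_zero {d : ℕ} (hδ : δ ≤ 1) (hδ' : δ' ≤ 1)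
    {T : Finset (ZMod (2 ^ k))}
    (h : pairWeight k p d (intervalSites (k + 1) (2 * a + p + δ) (2 * b + p + 1 - δ')) T ≠ 0) :
    ∃ x ∈ Finset.range (δ + 1), ∃ y ∈ Finset.range (δ' + 1),
      T = intervalSites k (a + x) (b - y) := by
  have hT := pairWeight_ne_zero h
  -- Only the end pairs can be cut, and `x, y` record whether `T` omits them. At an uncut end both
  -- branches give zero.
  refine ⟨if (a : ZMod (2 ^ k)) ∈ T then 0 else δ, by split_ifs <;> simp,
    if (b : ZMod (2 ^ k)) ∈ T then 0 else δ', by split_ifs <;> simp, ?_⟩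
  ext s
  constructor
  · intro hs
    obtain ⟨t, rfl, h1, h2⟩ := mem_of_pair_meets hδ hδ' ((hT s).1 hs)
    rw [intCast_mem_intervalSites]
    refine ⟨0, ?_, ?_⟩
    · split_ifs with ha
      · simpa using h1
      · have : t ≠ a := fun h => ha (h ▸ hs)
        omega
    · split_ifs with hb
      · simpa using h2
      · have : t ≠ b := fun h => hb (h ▸ hs)
        omega
  · intro hs
    obtain ⟨t, ht, rfl⟩ := Finset.mem_image.mp hs
    rw [Finset.mem_Icc] at ht
    by_cases h1 : a + δ ≤ t
    · by_cases h2 : t ≤ b - δ'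
      · obtain ⟨h3, h4⟩ := pair_mem_of_le (k := k) (p := p) h1 h2 hδ hδ'
        exact (hT _).2 h3 h4
      · split_ifs at ht with ha hb hb
        · have : t = b := by omega
          exact this ▸ hb
        · omega
        · have : t = b := by omega
          exact this ▸ hb
        · omega
    · split_ifs at ht with ha hb hb
      · have : t = a := by omega
        exact this ▸ ha
      · have : t = a := by omega
        exact this ▸ ha
      · omega
      · omega

/-- For an interval that is neither empty nor the whole ring, an end pair with a missing site is
really cut, since the other end does not wrap around to supply that site. Two cut end pairs are
distinct, so their factors multiply. -/
theorem pairWeight_interval_le {d : ℕ} (hd : 0 < d) (hδ : δ ≤ 1) (hδ' : δ' ≤ 1)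
    (h0 : 2 * a + p + δ < 2 * b + p + 2 - δ')
    (hN : 2 * b + p + 2 - (δ' : ℤ) < 2 * a + p + δ + 2 ^ (k + 1)) (T : Finset (ZMod (2 ^ k))) :
    pairWeight k p d (intervalSites (k + 1) (2 * a + p + δ) (2 * b + p + 1 - δ')) T ≤
      (d : ℝ)⁻¹ ^ (δ + δ') := by
  set A := intervalSites (k + 1) (2 * a + p + δ) (2 * b + p + 1 - δ') with hA
  have hmem : ∀ u : ℤ, ((u : ℤ) : ZMod (2 ^ (k + 1))) ∈ A ↔
      ∃ q : ℤ, 2 * a + p + δ ≤ u + 2 ^ (k + 1) * q ∧ u + 2 ^ (k + 1) * q ≤ 2 * b + p + 1 - δ' :=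
    fun u => intCast_mem_intervalSites _ _ _ _
  have hN1 : (0 : ℤ) < 2 ^ (k + 1) := by positivity
  have hout : ∀ u : ℤ, 2 * b + p + 1 - (δ' : ℤ) < u → u < 2 * a + p + δ + 2 ^ (k + 1) →
      ((u : ℤ) : ZMod (2 ^ (k + 1))) ∉ A := by
    intro u h1 h2 h
    obtain ⟨q, h3, h4⟩ := (hmem u).mp h
    rcases lt_trichotomy q 0 with hq | hq | hq
    · nlinarith
    · subst hq; omega
    · nlinarith
  have hleft : δ = 1 → ¬ (pairEquiv k p (Sum.inl (a : ZMod (2 ^ k))) ∈ A ↔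
      pairEquiv k p (Sum.inr (a : ZMod (2 ^ k))) ∈ A) := by
    intro h1
    rw [pairEquiv_inl, pairEquiv_inr, pairSite_intCast, pairSite_intCast]
    have e : ((2 * a + p : ℤ) : ZMod (2 ^ (k + 1))) = ((2 * a + p + 2 ^ (k + 1) : ℤ) : ZMod _) :=
      (intCast_zmod_two_pow_eq_iff _ _ _).mpr ⟨1, by ring⟩
    intro h
    have hin : ((2 * a + ((p + 1 : ℕ) : ℤ) : ℤ) : ZMod (2 ^ (k + 1))) ∈ A :=
      (hmem _).mpr ⟨0, by push_cast; omega, by push_cast; omega⟩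
    rw [← h, e] at hin
    exact hout _ (by omega) (by omega) hin
  have hright : δ' = 1 → ¬ (pairEquiv k p (Sum.inl (b : ZMod (2 ^ k))) ∈ A ↔
      pairEquiv k p (Sum.inr (b : ZMod (2 ^ k))) ∈ A) := by
    intro h1
    rw [pairEquiv_inl, pairEquiv_inr, pairSite_intCast, pairSite_intCast]
    intro h
    have hin : ((2 * b + p : ℤ) : ZMod (2 ^ (k + 1))) ∈ A :=
      (hmem _).mpr ⟨0, by omega, by omega⟩
    rw [h] at hin
    exact hout _ (by push_cast; omega) (by push_cast; omega) hin
  -- With both ends cut, `b = a` would make the interval empty and `b = a + 2 ^ k` would make it the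
  -- whole ring.
  have hne : δ = 1 → δ' = 1 → (a : ZMod (2 ^ k)) ≠ (b : ZMod (2 ^ k)) := by
    intro h1 h2 h
    obtain ⟨q, hq⟩ := (intCast_zmod_two_pow_eq_iff _ _ _).mp h
    have hk : (0 : ℤ) < 2 ^ k := by positivity
    rw [pow_succ] at hN
    subst h1 h2
    push_cast at h0 hN
    have hq0 : 0 < 2 ^ k * q := by omega
    have hq1 : 2 ^ k * q < 2 ^ k * 1 := by omega
    have := pos_of_mul_pos_right hq0 hk.le
    have := lt_of_mul_lt_mul_left hq1 hk.le
    omega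
  interval_cases δ <;> interval_cases δ'
  · simpa using pairWeight_le_pow hd A T ∅ (by simp)
  · simpa using pairWeight_le_pow hd A T {(b : ZMod (2 ^ k))} (by simpa using hright rfl)
  · simpa using pairWeight_le_pow hd A T {(a : ZMod (2 ^ k))} (by simpa using hleft rfl)
  · have := pairWeight_le_pow hd A T {(a : ZMod (2 ^ k)), (b : ZMod (2 ^ k))} (by
      intro s hs
      rcases Finset.mem_insert.mp hs with rfl | hs
      · exact hleft rfl
      · rw [Finset.mem_singleton.mp hs]
        exact hright rfl)
    rwa [Finset.card_pair (hne rfl rfl)] at this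

theorem sum_pairWeight_interval_le {d : ℕ} (hd : 0 < d) (hδ : δ ≤ 1) (hδ' : δ' ≤ 1)
    (h0 : 2 * a + p + δ < 2 * b + p + 2 - δ')
    (hN : 2 * b + p + 2 - (δ' : ℤ) < 2 * a + p + δ + 2 ^ (k + 1))
    (P : Finset (ZMod (2 ^ k)) → ℝ) {B : ℝ} (hB0 : 0 ≤ B)
    (hB : ∀ x ∈ Finset.range (δ + 1), ∀ y ∈ Finset.range (δ' + 1),
      P (intervalSites k (a + x) (b - y)) ≤ B) :
    ∑ T, pairWeight k p d (intervalSites (k + 1) (2 * a + p + δ) (2 * b + p + 1 - δ')) T * P T ≤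
      4 * ((d : ℝ)⁻¹ ^ (δ + δ') * B) := by
  set w := pairWeight k p d (intervalSites (k + 1) (2 * a + p + δ) (2 * b + p + 1 - δ')) with hw
  -- Different choices of endpoints may give the same set of sites, which must be counted once;
  -- hence an image, with at most four elements.
  set I : Finset (Finset (ZMod (2 ^ k))) := (Finset.range (δ + 1) ×ˢ Finset.range (δ' + 1)).image
    fun z => intervalSites k (a + z.1) (b - z.2) with hI
  have hsupp : ∀ T, T ∉ I → w T * P T = 0 := by
    intro T hT
    by_contra hne
    obtain ⟨x, hx, y, hy, h⟩ :=
      exists_interval_of_pairWeight_ne_zero hδ hδ' (left_ne_zero_of_mul hne)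
    exact hT (Finset.mem_image.mpr ⟨(x, y), Finset.mem_product.mpr ⟨hx, hy⟩, h.symm⟩)
  have hcard : I.card ≤ 4 := by
    refine Finset.card_image_le.trans ?_
    rw [Finset.card_product, Finset.card_range, Finset.card_range]
    exact Nat.mul_le_mul (by omega : δ + 1 ≤ 2) (by omega : δ' + 1 ≤ 2)
  rw [← Finset.sum_subset (Finset.subset_univ I) fun T _ hT => hsupp T hT]
  have hpos : 0 ≤ (d : ℝ)⁻¹ ^ (δ + δ') * B := by positivity
  calc _ ≤ ∑ _T ∈ I, (d : ℝ)⁻¹ ^ (δ + δ') * B := by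
        refine Finset.sum_le_sum fun T hT => ?_
        obtain ⟨z, hz, rfl⟩ := Finset.mem_image.mp hT
        rw [Finset.mem_product] at hz
        exact (mul_le_mul_of_nonneg_left (hB _ hz.1 _ hz.2) (pairWeight_nonneg _ _ _ _ _)).trans
          (mul_le_mul_of_nonneg_right (pairWeight_interval_le hd hδ hδ' h0 hN _) hB0)
    _ = I.card * ((d : ℝ)⁻¹ ^ (δ + δ') * B) := by simp
    _ ≤ _ := mul_le_mul_of_nonneg_right (by exact_mod_cast hcard) hpos

end Interval

end RandomMERA

namespace RandomMERA

open Finset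
open scoped ComplexConjugate

/-! ## The states of the network -/

section Network

variable {D D' : ℕ → ℕ}

theorem applyV_eq {k : ℕ} (V : VLayer D D' k) (v : StateVector k (D k)) :
    applyV V v = gate (fun s => (V s).1) v ∘ pairUp (pairEquiv k 0) := rfl

theorem applyW_eq {k : ℕ} (W : WLayer D D' k) (v : StateVector (k + 1) (D' (k + 1))) :
    applyW W v = gate (fun s => (W s).1) (v ∘ (pairUp (pairEquiv k 1)).symm) ∘
      pairUp (pairEquiv k 1) := by
  ext z
  simp only [applyW, gate, Function.comp]
  rw [← (pairUp (pairEquiv k 1)).sum_comp]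
  simp only [Equiv.symm_apply_apply]
  rfl

theorem applyV_unit {k : ℕ} (V : VLayer D D' k) {v : StateVector k (D k)}
    (hv : ∑ x, v x * conj (v x) = 1) : ∑ x, applyV V v x * conj (applyV V v x) = 1 := by
  rw [applyV_eq, norm_comp_pairUp, norm_gate _ fun s => (V s).2, hv]

theorem applyW_unit {k : ℕ} (W : WLayer D D' k) {v : StateVector (k + 1) (D' (k + 1))}
    (hv : ∑ x, v x * conj (v x) = 1) : ∑ x, applyW W v x * conj (applyW W v x) = 1 := by
  rw [applyW_eq, norm_comp_pairUp, norm_gate _ fun s => (W s).2, ← hv]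
  exact (pairUp (pairEquiv k 1)).symm.sum_comp fun x => v x * conj (v x)

theorem psi_unit (h0 : D 0 = 1) : ∀ (L : ℕ) (c : Circuit D D' L),
    ∑ x, psi L c x * conj (psi L c x) = 1
  | 0, c => by simp [psi, h0]
  | L + 1, c => applyW_unit _ (applyV_unit _ (psi_unit h0 L c.1))

theorem phi_unit (h0 : D 0 = 1) (L : ℕ) (c : Circuit D D' (L + 1)) :
    ∑ x, phi L c x * conj (phi L c x) = 1 := applyV_unit _ (psi_unit h0 L c.1)

theorem intervalEntropy_eq {k d : ℕ} (v : StateVector k d) (i j : ℤ) :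
    intervalEntropy v i j = setEntropy (intervalSites k i j) v :=
  vonNeumannEntropy_eq_specEntropy _

theorem setEntropy_applyV {k : ℕ} (V : VLayer D D' k) (v : StateVector k (D k)) (a b : ℤ) :
    setEntropy (intervalSites (k + 1) (2 * a) (2 * b + 1)) (applyV V v) =
      setEntropy (intervalSites k a b) v := by
  rw [applyV_eq]
  refine (setEntropy_comp_pairUp _ _ (fun s => ?_) (fun s => ?_)).trans
    (setEntropy_gate _ (fun s => (V s).2) v _)
  · simpa using pairEquiv_inl_mem k 0 a b s
  · simpa using pairEquiv_inr_mem k 0 a b s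

theorem setEntropy_applyW {k : ℕ} (W : WLayer D D' k) (v : StateVector (k + 1) (D' (k + 1)))
    (a b : ℤ) :
    setEntropy (intervalSites (k + 1) (2 * a + 1) (2 * b + 2)) (applyW W v) =
      setEntropy (intervalSites (k + 1) (2 * a + 1) (2 * b + 2)) v := by
  have e1 : ∀ s, pairEquiv k 1 (Sum.inl s) ∈ intervalSites (k + 1) (2 * a + 1) (2 * b + 2) ↔
      s ∈ intervalSites k a b := fun s => by
    simpa [add_assoc] using pairEquiv_inl_mem k 1 a b s
  have e2 : ∀ s, pairEquiv k 1 (Sum.inr s) ∈ intervalSites (k + 1) (2 * a + 1) (2 * b + 2) ↔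
      s ∈ intervalSites k a b := fun s => by
    simpa [add_assoc] using pairEquiv_inr_mem k 1 a b s
  rw [applyW_eq, setEntropy_comp_pairUp _ _ e1 e2, setEntropy_gate _ fun s => (W s).2,
    ← setEntropy_comp_pairUp _ _ e1 e2]
  congr 1
  ext x
  simp

/-- No bound on the length is needed: past one full turn the added site is already present, and the
insertion lemmas allow this. -/
theorem setEntropy_interval_left {k d : ℕ} (hd : 0 < d) {v : StateVector k d}
    (hv : ∑ x, v x * conj (v x) = 1) {i j m : ℤ} (h : |m - i| ≤ 1) :
    setEntropy (intervalSites k i j) v ≤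
      setEntropy (intervalSites k m j) v + Real.log d * (|m - i| : ℤ) := by
  have : Nonempty (Fin d) := ⟨⟨0, hd⟩⟩
  have hins : ∀ i : ℤ, i ≤ j → intervalSites k i j =
      insert (i : ZMod (2 ^ k)) (intervalSites k (i + 1) j) := by
    intro i hij
    rw [intervalSites, intervalSites, ← Finset.image_insert,
      ← Finset.insert_Icc_add_one_left_eq_Icc hij]
  have hemp : ∀ i : ℤ, j < i → intervalSites k i j = ∅ := by
    intro i hij
    rw [intervalSites, Finset.Icc_eq_empty (by omega), Finset.image_empty]
  have hlog : 0 ≤ Real.log d := Real.log_natCast_nonneg d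
  obtain ⟨h1, h2⟩ := abs_le.mp h
  have hc : m = i ∨ m = i + 1 ∨ i = m + 1 := by omega
  rcases hc with rfl | rfl | rfl
  · simp
  · rw [show |i + 1 - i| = 1 by simp]
    by_cases hij : i ≤ j
    · rw [hins i hij]
      simpa using setEntropy_insert_le (intervalSites k (i + 1) j) (i : ZMod (2 ^ k)) hv
    · rw [hemp i (by omega), hemp (i + 1) (by omega)]
      simpa using hlog
  · rw [show |m - (m + 1)| = 1 by simp]
    by_cases hij : m ≤ j
    · rw [hins m hij]
      simpa using setEntropy_le_insert (intervalSites k (m + 1) j) (m : ZMod (2 ^ k)) hv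
    · rw [hemp m (by omega), hemp (m + 1) (by omega)]
      simpa using hlog

theorem setEntropy_interval_right {k d : ℕ} (hd : 0 < d) {v : StateVector k d}
    (hv : ∑ x, v x * conj (v x) = 1) {i j n : ℤ} (h : |n - j| ≤ 1) :
    setEntropy (intervalSites k i j) v ≤
      setEntropy (intervalSites k i n) v + Real.log d * (|n - j| : ℤ) := by
  have : Nonempty (Fin d) := ⟨⟨0, hd⟩⟩
  have hins : ∀ j : ℤ, i ≤ j + 1 → intervalSites k i (j + 1) =
      insert ((j + 1 : ℤ) : ZMod (2 ^ k)) (intervalSites k i j) := by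
    intro j hij
    rw [intervalSites, intervalSites, ← Finset.image_insert]
    congr 1
    ext t
    simp only [Finset.mem_Icc, Finset.mem_insert]
    omega
  have hemp : ∀ j : ℤ, j < i → intervalSites k i j = ∅ := by
    intro j hij
    rw [intervalSites, Finset.Icc_eq_empty (by omega), Finset.image_empty]
  have hlog : 0 ≤ Real.log d := Real.log_natCast_nonneg d
  obtain ⟨h1, h2⟩ := abs_le.mp h
  have hc : n = j ∨ n = j + 1 ∨ j = n + 1 := by omega
  rcases hc with rfl | rfl | rfl
  · simp
  · rw [show |j + 1 - j| = 1 by simp]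
    by_cases hij : i ≤ j + 1
    · rw [hins j hij]
      simpa using setEntropy_le_insert (intervalSites k i j) ((j + 1 : ℤ) : ZMod (2 ^ k)) hv
    · rw [hemp j (by omega), hemp (j + 1) (by omega)]
      simpa using hlog
  · rw [show |n - (n + 1)| = 1 by simp]
    by_cases hij : i ≤ n + 1
    · rw [hins n hij]
      simpa using setEntropy_insert_le (intervalSites k i n) ((n + 1 : ℤ) : ZMod (2 ^ k)) hv
    · rw [hemp n (by omega), hemp (n + 1) (by omega)]
      simpa using hlog

theorem setEntropy_interval_le {k d : ℕ} (hd : 0 < d) {v : StateVector k d}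
    (hv : ∑ x, v x * conj (v x) = 1) {i j m n : ℤ} (hm : |m - i| ≤ 1) (hn : |n - j| ≤ 1) :
    setEntropy (intervalSites k i j) v ≤
      Real.log d * ((|m - i| + |n - j| : ℤ) : ℝ) + setEntropy (intervalSites k m n) v := by
  have h1 := setEntropy_interval_left hd hv (j := j) hm
  have h2 := setEntropy_interval_right hd hv (i := m) hn
  rw [Int.cast_add, mul_add]
  linarith

theorem setEntropy_interval_of_dvd {k d : ℕ} {v : StateVector k d}
    (hv : ∑ x, v x * conj (v x) = 1) {i j : ℤ} (h : (2 : ℤ) ^ k ∣ j + 1 - i) :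
    setEntropy (intervalSites k i j) v = 0 := by
  obtain ⟨q, hq⟩ := h
  have hN : (0 : ℤ) < 2 ^ k := by positivity
  rcases le_or_gt q 0 with h0 | h0
  · have : intervalSites k i j = ∅ := by
      rw [intervalSites, Finset.Icc_eq_empty (by nlinarith), Finset.image_empty]
    rw [this, setEntropy_empty hv]
  · have : intervalSites k i j = Finset.univ := by
      refine Finset.eq_univ_iff_forall.mpr fun s => ?_
      obtain ⟨t, rfl⟩ := exists_intCast_eq s
      rw [intCast_mem_intervalSites]
      have e := Int.emod_add_mul_ediv (t - i) (2 ^ k)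
      have e1 := Int.emod_nonneg (t - i) hN.ne'
      have e2 := Int.emod_lt_of_pos (t - i) hN
      refine ⟨-((t - i) / 2 ^ k), ?_, ?_⟩
      · rw [mul_neg]
        linarith
      · rw [mul_neg]
        nlinarith
    rw [this, setEntropy_univ hv]

/-! ## Measurability and averages -/

theorem nonempty_isometryMatrix {m n : Type} [Fintype m] [DecidableEq m] [Fintype n]
    [DecidableEq n] (h : Fintype.card n ≤ Fintype.card m) : Nonempty (IsometryMatrix m n) := by
  obtain ⟨f⟩ := Function.Embedding.nonempty_of_card_le h
  refine ⟨⟨Matrix.of fun i a => if i = f a then 1 else 0, ?_⟩⟩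
  ext a b
  simp [Matrix.mul_apply, Matrix.one_apply, eq_comm (a := a)]

theorem nonempty_V {k : ℕ} (h : D k ≤ D' (k + 1) ^ 2) :
    Nonempty (IsometryMatrix (Fin (D' (k + 1)) × Fin (D' (k + 1))) (Fin (D k))) :=
  nonempty_isometryMatrix (by simpa [sq] using h)

theorem nonempty_W {k : ℕ} (h : D' (k + 1) ≤ D (k + 1)) :
    Nonempty (IsometryMatrix (Fin (D (k + 1)) × Fin (D (k + 1)))
      (Fin (D' (k + 1)) × Fin (D' (k + 1)))) :=
  nonempty_isometryMatrix (by simpa using Nat.mul_le_mul h h)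

/-- The distribution of a layer `V`. -/
noncomputable abbrev measureV (D D' : ℕ → ℕ) (k : ℕ) : Measure (VLayer D D' k) :=
  Measure.pi fun _ => haarIsometry _ _

/-- The distribution of a layer `W`. -/
noncomputable abbrev measureW (D D' : ℕ → ℕ) (k : ℕ) : Measure (WLayer D D' k) :=
  Measure.pi fun _ => haarIsometry _ _

theorem isProbabilityMeasure_measureV {k : ℕ} (h : D k ≤ D' (k + 1) ^ 2) :
    IsProbabilityMeasure (measureV D D' k) := by
  have := nonempty_V h
  have := isProbabilityMeasure_haarIsometry (Fin (D' (k + 1)) × Fin (D' (k + 1))) (Fin (D k))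
  infer_instance

theorem isProbabilityMeasure_measureW {k : ℕ} (h : D' (k + 1) ≤ D (k + 1)) :
    IsProbabilityMeasure (measureW D D' k) := by
  have := nonempty_W h
  have := isProbabilityMeasure_haarIsometry (Fin (D (k + 1)) × Fin (D (k + 1)))
      (Fin (D' (k + 1)) × Fin (D' (k + 1)))
  infer_instance

theorem isProbabilityMeasure_circuitMeasure : ∀ (L : ℕ),
    (∀ k < L, D k ≤ D' (k + 1) ^ 2 ∧ D' (k + 1) ≤ D (k + 1)) →
    IsProbabilityMeasure (circuitMeasure D D' L)
  | 0, _ => inferInstanceAs (IsProbabilityMeasure (Measure.dirac () : Measure Unit))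
  | L + 1, h => by
    have := isProbabilityMeasure_circuitMeasure L fun k hk => h k (by omega)
    have := isProbabilityMeasure_measureV (h L (by omega)).1
    have := isProbabilityMeasure_measureW (h L (by omega)).2
    exact inferInstanceAs (IsProbabilityMeasure ((circuitMeasure D D' L).prod
      ((measureV D D' L).prod (measureW D D' L))))

theorem measurable_applyV {Ω : Type*} [MeasurableSpace Ω] {k : ℕ} {V : Ω → VLayer D D' k}
    {v : Ω → StateVector k (D k)} (hV : Measurable V) (hv : ∀ x, Measurable fun c => v c x)
    (y : ZMod (2 ^ (k + 1)) → Fin (D' (k + 1))) : Measurable fun c => applyV (V c) (v c) y := by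
  unfold applyV
  refine Finset.measurable_sum _ fun x _ => (Finset.measurable_prod _ fun s _ => ?_).mul (hv x)
  exact (continuous_isometryMatrix_apply _ _).measurable.comp ((measurable_pi_apply s).comp hV)

theorem measurable_applyW {Ω : Type*} [MeasurableSpace Ω] {k : ℕ} {W : Ω → WLayer D D' k}
    {v : Ω → StateVector (k + 1) (D' (k + 1))} (hW : Measurable W)
    (hv : ∀ x, Measurable fun c => v c x)
    (y : ZMod (2 ^ (k + 1)) → Fin (D (k + 1))) : Measurable fun c => applyW (W c) (v c) y := by
  unfold applyW
  refine Finset.measurable_sum _ fun x _ => (Finset.measurable_prod _ fun s _ => ?_).mul (hv x)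
  exact (continuous_isometryMatrix_apply _ _).measurable.comp ((measurable_pi_apply s).comp hW)

theorem measurable_circuit_fst (L : ℕ) :
    Measurable fun c : Circuit D D' (L + 1) => (c.1 : Circuit D D' L) :=
  measurable_fst (α := Circuit D D' L) (β := VLayer D D' L × WLayer D D' L)

theorem measurable_circuit_V (L : ℕ) :
    Measurable fun c : Circuit D D' (L + 1) => (c.2.1 : VLayer D D' L) :=
  measurable_fst.comp (measurable_snd (α := Circuit D D' L) (β := VLayer D D' L × WLayer D D' L))

theorem measurable_circuit_W (L : ℕ) :
    Measurable fun c : Circuit D D' (L + 1) => (c.2.2 : WLayer D D' L) :=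
  measurable_snd.comp (measurable_snd (α := Circuit D D' L) (β := VLayer D D' L × WLayer D D' L))

theorem measurable_psi : ∀ (L : ℕ) (x : ZMod (2 ^ L) → Fin (D L)),
    Measurable fun c : Circuit D D' L => psi L c x
  | 0, _ => measurable_const
  | L + 1, x => measurable_applyW (measurable_circuit_W L)
      (measurable_applyV (measurable_circuit_V L)
        fun y => (measurable_psi L y).comp (measurable_circuit_fst L)) x

theorem measurable_phi (L : ℕ) (x : ZMod (2 ^ (L + 1)) → Fin (D' (L + 1))) :
    Measurable fun c : Circuit D D' (L + 1) => phi L c x :=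
  measurable_applyV (measurable_circuit_V L)
    (fun y => (measurable_psi L y).comp (measurable_circuit_fst L)) x

end Network

section Averages

variable {ι α Ω : Type} [Fintype ι] [DecidableEq ι] [Fintype α] [DecidableEq α]
  [MeasurableSpace Ω] {v : Ω → (ι → α) → ℂ} (A : Finset ι) {μ : Measure Ω}

theorem integrable_setEntropy [IsFiniteMeasure μ] (hm : ∀ x, Measurable fun c => v c x)
    (hv : ∀ c, ∑ x, v c x * conj (v c x) = 1) : Integrable (fun c => setEntropy A (v c)) μ := by
  have hmeas : Measurable fun c => setEntropy A (v c) := by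
    refine measurable_specEntropy (fun x x' => ?_) (fun c => posSemidef_reduced_density A (v c))
      fun c => (trace_reduced_density A (v c)).trans (hv c)
    simp only [reduced, density, Matrix.vecMulVec_apply, Pi.star_apply, RCLike.star_def]
    exact Finset.measurable_sum _ fun z _ =>
      (hm _).mul (Complex.continuous_conj.measurable.comp (hm _))
  refine Integrable.of_bound hmeas.aestronglyMeasurable
    (Fintype.card ({s // s ∈ A} → α)) (Filter.Eventually.of_forall fun c => ?_)
  rw [setEntropy, Real.norm_of_nonneg (specEntropy_nonneg (posSemidef_reduced_density A (v c))
    ((trace_reduced_density A (v c)).trans (hv c)))]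
  exact specEntropy_le_card (posSemidef_reduced_density A (v c))

theorem integrable_purity [IsFiniteMeasure μ] (hm : ∀ x, Measurable fun c => v c x)
    (hv : ∀ c, ∑ x, v c x * conj (v c x) = 1) : Integrable (fun c => purity A (v c)) μ := by
  have hmeas : Measurable fun c => purity A (v c) := by
    unfold purity
    exact Finset.measurable_sum _ fun x _ => Finset.measurable_sum _ fun x' _ =>
      (((hm _).mul (hm _)).mul (Complex.continuous_conj.measurable.comp (hm _))).mul
        (Complex.continuous_conj.measurable.comp (hm _))
  exact Integrable.of_bound hmeas.aestronglyMeasurable 1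
    (Filter.Eventually.of_forall fun c => norm_purity_le_one A (hv c))

/-- The average entropy is at least minus the logarithm of a bound on the average purity. -/
theorem le_integral_setEntropy [IsProbabilityMeasure μ] (hm : ∀ x, Measurable fun c => v c x)
    (hv : ∀ c, ∑ x, v c x * conj (v c x) = 1) {s : ℝ}
    (h : (∫ c, purity A (v c) ∂μ).re ≤ Real.exp (-s)) : s ≤ ∫ c, setEntropy A (v c) ∂μ := by
  have hP := integrable_purity A hm hv (μ := μ)
  have hE := integrable_setEntropy A hm hv (μ := μ)
  have hPre : Integrable (fun c => (purity A (v c)).re) μ := hP.re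
  have hre : ∫ c, (purity A (v c)).re ∂μ = (∫ c, purity A (v c) ∂μ).re := integral_re hP
  calc s ≤ s + 1 - (∫ c, (purity A (v c)).re ∂μ) / Real.exp (-s) := by
        rw [hre]
        have := (div_le_one (Real.exp_pos (-s))).mpr h
        linarith
    _ = ∫ c, (s + 1 - (purity A (v c)).re / Real.exp (-s)) ∂μ := by
        rw [integral_sub (integrable_const _) (hPre.div_const _), integral_div]
        simp
    _ ≤ _ := by
        refine integral_mono ((integrable_const _).sub (hPre.div_const _)) hE fun c => ?_
        have := le_specEntropy_of_trace_sq (posSemidef_reduced_density A (v c))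
          ((trace_reduced_density A (v c)).trans (hv c)) (Real.exp_pos (-s))
        rw [Real.log_exp, neg_neg, ← purity_eq_trace] at this
        exact this

end Averages

/-! ### Averaging the purity over the last layer -/

section Recursion

variable {D D' : ℕ → ℕ}

/-- By Fubini, the last layer `W` is averaged first with everything else fixed. The remaining
integrand does not depend on `W`, so it may still be integrated over the whole circuit. -/
theorem integral_purity_psi_succ {L : ℕ} (h0 : D 0 = 1) (hd : 0 < D (L + 1))
    (h : ∀ k < L + 1, D k ≤ D' (k + 1) ^ 2 ∧ D' (k + 1) ≤ D (k + 1))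
    (A : Finset (ZMod (2 ^ (L + 1)))) :
    ∫ c, purity A (psi (L + 1) c) ∂circuitMeasure D D' (L + 1) =
      ∑ T, (pairWeight L 1 (D (L + 1)) A T : ℂ) *
        ∫ c, purity T (phi L c ∘ (pairUp (pairEquiv L 1)).symm) ∂circuitMeasure D D' (L + 1) := by
  have := nonempty_W (h L (by omega)).2
  have := isProbabilityMeasure_circuitMeasure L fun k hk => h k (by omega)
  have := isProbabilityMeasure_measureV (h L (by omega)).1
  have := isProbabilityMeasure_measureW (h L (by omega)).2
  have hprob := isProbabilityMeasure_circuitMeasure (L + 1) h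
  have hint : ∀ T, Integrable (fun c => purity T (phi L c ∘ (pairUp (pairEquiv L 1)).symm))
      (circuitMeasure D D' (L + 1)) := by
    intro T
    refine integrable_purity T (fun x => measurable_phi L _) fun c => ?_
    rw [← phi_unit h0 L c]
    exact (pairUp (pairEquiv L 1)).symm.sum_comp fun x => phi L c x * conj (phi L c x)
  have hF : Integrable (fun c => purity A (psi (L + 1) c)) (circuitMeasure D D' (L + 1)) :=
    integrable_purity A (measurable_psi (L + 1)) (psi_unit h0 (L + 1))
  have hG := integrable_finsetSum Finset.univ fun T _ =>
    (hint T).const_mul (pairWeight L 1 (D (L + 1)) A T : ℂ)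
  simp only [← integral_const_mul]
  rw [← integral_finsetSum _ fun T _ => (hint T).const_mul _]
  have key : ∀ (F G : Circuit D D' L × VLayer D D' L × WLayer D D' L → ℂ),
      Integrable F ((circuitMeasure D D' L).prod ((measureV D D' L).prod (measureW D D' L))) →
      Integrable G ((circuitMeasure D D' L).prod ((measureV D D' L).prod (measureW D D' L))) →
      (∀ c V, ∫ W, F (c, V, W) ∂measureW D D' L = ∫ W, G (c, V, W) ∂measureW D D' L) →
      ∫ c, F c ∂((circuitMeasure D D' L).prod ((measureV D D' L).prod (measureW D D' L))) =
      ∫ c, G c ∂((circuitMeasure D D' L).prod ((measureV D D' L).prod (measureW D D' L))) := by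
    intro F G hF hG hFG
    rw [integral_prod _ hF, integral_prod _ hG]
    refine integral_congr_ae ?_
    filter_upwards [hF.prod_right_ae, hG.prod_right_ae] with c h1 h2
    rw [integral_prod _ h1, integral_prod _ h2]
    exact integral_congr_ae (Filter.Eventually.of_forall fun V => hFG c V)
  refine key _ _ hF hG fun c V => ?_
  have e := integral_purity_gate hd (pairEquiv L 1) A
    (applyV V (psi L c) ∘ (pairUp (pairEquiv L 1)).symm)
  simp only [← applyW_eq] at e
  refine e.trans ?_
  simp only [phi, integral_const, probReal_univ, one_smul, pairWeight]
  push_cast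
  rfl

/-- The last `W` does not enter `phi` and integrates to one; averaging over the last `V` then leaves
a circuit with one level less. -/
theorem integral_purity_phi {L : ℕ} (h0 : D 0 = 1) (hd : 0 < D' (L + 1))
    (h : ∀ k < L + 1, D k ≤ D' (k + 1) ^ 2 ∧ D' (k + 1) ≤ D (k + 1))
    (A : Finset (ZMod (2 ^ (L + 1)))) :
    ∫ c, purity A (phi L c) ∂circuitMeasure D D' (L + 1) =
      ∑ T, (pairWeight L 0 (D' (L + 1)) A T : ℂ) *
        ∫ c, purity T (psi L c) ∂circuitMeasure D D' L := by
  have := nonempty_V (h L (by omega)).1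
  have := isProbabilityMeasure_circuitMeasure L fun k hk => h k (by omega)
  have := isProbabilityMeasure_measureV (h L (by omega)).1
  have := isProbabilityMeasure_measureW (h L (by omega)).2
  have hprob := isProbabilityMeasure_circuitMeasure (L + 1) h
  have hF : Integrable (fun c => purity A (phi L c)) (circuitMeasure D D' (L + 1)) :=
    integrable_purity A (measurable_phi L) (phi_unit h0 L)
  have hint : ∀ T, Integrable (fun c => purity T (psi L c)) (circuitMeasure D D' L) := fun T =>
    integrable_purity T (measurable_psi L) (psi_unit h0 L)
  simp only [← integral_const_mul]
  rw [← integral_finsetSum _ fun T _ => (hint T).const_mul _]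
  have key : ∀ (F : Circuit D D' L × VLayer D D' L × WLayer D D' L → ℂ)
      (F' : Circuit D D' L → VLayer D D' L → ℂ) (G : Circuit D D' L → ℂ),
      Integrable F ((circuitMeasure D D' L).prod ((measureV D D' L).prod (measureW D D' L))) →
      (∀ c V W, F (c, V, W) = F' c V) →
      (∀ c, ∫ V, F' c V ∂measureV D D' L = G c) →
      ∫ c, F c ∂((circuitMeasure D D' L).prod ((measureV D D' L).prod (measureW D D' L))) =
      ∫ c, G c ∂circuitMeasure D D' L := by
    intro F F' G hF hFF' hG
    rw [integral_prod _ hF]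
    refine integral_congr_ae ?_
    filter_upwards [hF.prod_right_ae] with c h1
    rw [integral_prod _ h1]
    simp only [hFF', integral_const, probReal_univ, one_smul, hG]
  refine key _ (fun c V => purity A (applyV V (psi L c))) _ hF (fun c V W => rfl) fun c => ?_
  have e := integral_purity_gate hd (pairEquiv L 0) A (psi L c)
  simp only [← applyV_eq] at e
  refine e.trans ?_
  simp only [pairWeight]
  push_cast
  rfl

end Recursion

end RandomMERA

namespace RandomMERA

open Finset

/-! ## Reduction sequences -/

namespace ReductionSequence

theorem nonempty_of_nonempty_tau {k : ℕ} (h : ∀ i j, Nonempty (ReductionSequence Row.tau k i j))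
    (i j : ℤ) : Nonempty (ReductionSequence Row.sigma k i j) := by
  by_cases hd : (2 : ℤ) ^ k ∣ j + 1 - i
  · exact ⟨nil hd⟩
  · obtain ⟨m, hm, hmi⟩ : ∃ m : ℤ, Odd m ∧ |m - i| ≤ 1 := by
      rcases Int.even_or_odd i with hi | hi
      · exact ⟨i + 1, hi.add_one, by simp⟩
      · exact ⟨i, hi, by simp⟩
    obtain ⟨n, hn, hnj⟩ : ∃ n : ℤ, Even n ∧ |n - j| ≤ 1 := by
      rcases Int.even_or_odd j with hj | hj
      · exact ⟨j, hj, by simp⟩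
      · exact ⟨j + 1, hj.add_one, by simp⟩
    obtain ⟨Q⟩ := h m n
    exact ⟨sigmaStep hd m n hm hn hmi hnj Q⟩

theorem nonempty_tau : ∀ (k : ℕ) (i j : ℤ), Nonempty (ReductionSequence Row.tau k i j)
  | 0, i, j => ⟨nil (by simp)⟩
  | k + 1, i, j => by
    by_cases hd : (2 : ℤ) ^ (k + 1) ∣ j + 1 - i
    · exact ⟨nil hd⟩
    · obtain ⟨m, hm, hmi⟩ : ∃ m : ℤ, Even m ∧ |m - i| ≤ 1 := by
        rcases Int.even_or_odd i with hi | hi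
        · exact ⟨i, hi, by simp⟩
        · exact ⟨i + 1, hi.add_one, by simp⟩
      obtain ⟨n, hn, hnj⟩ : ∃ n : ℤ, Odd n ∧ |n - j| ≤ 1 := by
        rcases Int.even_or_odd j with hj | hj
        · exact ⟨j + 1, hj.add_one, by simp⟩
        · exact ⟨j, hj, by simp⟩
      obtain ⟨Q⟩ := nonempty_of_nonempty_tau (nonempty_tau k) (m / 2) ((n - 1) / 2)
      exact ⟨tauStep hd m n hm hn hmi hnj Q⟩

instance nonempty : ∀ (r : Row) (k : ℕ) (i j : ℤ), Nonempty (ReductionSequence r k i j)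
  | Row.sigma, k, i, j => nonempty_of_nonempty_tau (nonempty_tau k) i j
  | Row.tau, k, i, j => nonempty_tau k i j

/-- A sequence either stops or is determined by one of finitely many first moves and its remainder;
the divisibility conditions exclude having both. With nonemptiness, finiteness makes the minima
exist. -/
theorem finite_of_finite_tau {k : ℕ} (h : ∀ i j, Finite (ReductionSequence Row.tau k i j))
    (i j : ℤ) : Finite (ReductionSequence Row.sigma k i j) := by
  let f : ReductionSequence Row.sigma k i j → Option (Σ p : Set.Icc (i - 1) (i + 1) ×
      Set.Icc (j - 1) (j + 1), ReductionSequence Row.tau k p.1 p.2) := fun Q =>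
    match Q with
    | nil _ => none
    | sigmaStep _ m n _ _ hmi hnj rest =>
      some ⟨(⟨m, by have := abs_le.mp hmi; constructor <;> omega⟩,
        ⟨n, by have := abs_le.mp hnj; constructor <;> omega⟩), rest⟩
  refine Finite.of_injective f fun Q Q' hQ => ?_
  cases Q with
  | nil h =>
    cases Q' with
    | nil h' => rfl
    | sigmaStep h' => exact absurd h h'
  | sigmaStep h m n hm hn hmi hnj rest =>
    cases Q' with
    | nil h' => exact absurd h' h
    | sigmaStep h' m' n' hm' hn' hmi' hnj' rest' =>
      simp only [f, Option.some.injEq, Sigma.mk.injEq] at hQ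
      obtain ⟨h1, h3⟩ := hQ
      obtain rfl : m = m' := congrArg (fun p => (p.1 : ℤ)) h1
      obtain rfl : n = n' := congrArg (fun p => (p.2 : ℤ)) h1
      rw [eq_of_heq h3]

theorem finite_tau : ∀ (k : ℕ) (i j : ℤ), Finite (ReductionSequence Row.tau k i j)
  | 0, i, j => by
    refine Finite.of_injective (fun _ => ()) fun Q Q' _ => ?_
    cases Q with
    | nil h =>
      cases Q' with
      | nil h' => rfl
  | k + 1, i, j => by
    have hfin := finite_of_finite_tau (finite_tau k)
    let f : ReductionSequence Row.tau (k + 1) i j → Option (Σ p : Set.Icc (i - 1) (i + 1) ×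
        Set.Icc (j - 1) (j + 1),
        ReductionSequence Row.sigma k ((p.1 : ℤ) / 2) (((p.2 : ℤ) - 1) / 2)) := fun Q =>
      match Q with
      | nil _ => none
      | tauStep _ m n _ _ hmi hnj rest =>
        some ⟨(⟨m, by have := abs_le.mp hmi; constructor <;> omega⟩,
          ⟨n, by have := abs_le.mp hnj; constructor <;> omega⟩), rest⟩
    refine Finite.of_injective f fun Q Q' hQ => ?_
    cases Q with
    | nil h =>
      cases Q' with
      | nil h' => rfl
      | tauStep h' => exact absurd h h'
    | tauStep h m n hm hn hmi hnj rest =>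
      cases Q' with
      | nil h' => exact absurd h' h
      | tauStep h' m' n' hm' hn' hmi' hnj' rest' =>
        simp only [f, Option.some.injEq, Sigma.mk.injEq] at hQ
        obtain ⟨h1, h3⟩ := hQ
        obtain rfl : m = m' := congrArg (fun p => (p.1 : ℤ)) h1
        obtain rfl : n = n' := congrArg (fun p => (p.2 : ℤ)) h1
        rw [eq_of_heq h3]

instance finite : ∀ (r : Row) (k : ℕ) (i j : ℤ), Finite (ReductionSequence r k i j)
  | Row.sigma, k, i, j => finite_of_finite_tau (finite_tau k) i j
  | Row.tau, k, i, j => finite_tau k i j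

theorem exists_isLeast {r : Row} {k : ℕ} {i j : ℤ} (f : ReductionSequence r k i j → ℝ) :
    ∃ Q, IsLeast (Set.range f) (f Q) := by
  obtain ⟨Q, hQ⟩ := Finite.exists_min f
  exact ⟨Q, ⟨Q, rfl⟩, by rintro _ ⟨Q', rfl⟩; exact hQ Q'⟩

end ReductionSequence

section Bounds

open ReductionSequence

variable {D D' : ℕ → ℕ}

/-- Positivity is not assumed separately: it propagates from `D 0 = 1` through the inequalities. -/
theorem dim_pos (h0 : D 0 = 1) : ∀ (L : ℕ),
    (∀ k < L, D k ≤ D' (k + 1) ^ 2 ∧ D' (k + 1) ≤ D (k + 1)) → 0 < D L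
  | 0, _ => by omega
  | L + 1, h => by
    have h1 := dim_pos h0 L fun k hk => h k (by omega)
    obtain ⟨h2, h3⟩ := h L (by omega)
    have : 0 < D' (L + 1) := Nat.pos_of_ne_zero fun h4 => by simp [h4] at h2; omega
    omega

theorem dim_pos' (h0 : D 0 = 1) (L : ℕ)
    (h : ∀ k < L + 1, D k ≤ D' (k + 1) ^ 2 ∧ D' (k + 1) ≤ D (k + 1)) : 0 < D' (L + 1) := by
  have h1 := dim_pos h0 L fun k hk => h k (by omega)
  have h2 := (h L (by omega)).1
  exact Nat.pos_of_ne_zero fun h4 => by simp [h4] at h2; omega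

/-! ### The upper bound -/

theorem setEntropy_phi_le_of_psi (h0 : D 0 = 1) (L : ℕ)
    (h : ∀ k < L + 1, D k ≤ D' (k + 1) ^ 2 ∧ D' (k + 1) ≤ D (k + 1))
    (ih : ∀ (c : Circuit D D' L) (i j : ℤ) (Q : ReductionSequence Row.sigma L i j),
      setEntropy (intervalSites L i j) (psi L c) ≤ Q.cost D D')
    (c : Circuit D D' (L + 1)) (i j : ℤ) (Q : ReductionSequence Row.tau (L + 1) i j) :
    setEntropy (intervalSites (L + 1) i j) (phi L c) ≤ Q.cost D D' := by
  cases Q with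
  | nil hd => exact (setEntropy_interval_of_dvd (phi_unit h0 L c) hd).le
  | tauStep hd m n hm hn hmi hnj rest =>
    refine (setEntropy_interval_le (dim_pos' h0 L h) (phi_unit h0 L c) hmi hnj).trans ?_
    have e := setEntropy_applyV c.2.1 (psi L c.1) (m / 2) ((n - 1) / 2)
    have h1 : 2 * (m / 2) = m := Int.two_mul_ediv_two_of_even hm
    have h2 : 2 * ((n - 1) / 2) + 1 = n := by
      obtain ⟨t, rfl⟩ := hn
      omega
    rw [h1, h2] at e
    have := ih c.1 _ _ rest
    rw [← e] at this
    rw [cost]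
    exact add_le_add le_rfl this

theorem setEntropy_psi_le_of_phi (h0 : D 0 = 1) (L : ℕ)
    (h : ∀ k < L + 1, D k ≤ D' (k + 1) ^ 2 ∧ D' (k + 1) ≤ D (k + 1))
    (ih : ∀ (c : Circuit D D' (L + 1)) (i j : ℤ) (Q : ReductionSequence Row.tau (L + 1) i j),
      setEntropy (intervalSites (L + 1) i j) (phi L c) ≤ Q.cost D D')
    (c : Circuit D D' (L + 1)) (i j : ℤ) (Q : ReductionSequence Row.sigma (L + 1) i j) :
    setEntropy (intervalSites (L + 1) i j) (psi (L + 1) c) ≤ Q.cost D D' := by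
  cases Q with
  | nil hd => exact (setEntropy_interval_of_dvd (psi_unit h0 (L + 1) c) hd).le
  | sigmaStep hd m n hm hn hmi hnj rest =>
    refine (setEntropy_interval_le (dim_pos h0 (L + 1) h) (psi_unit h0 (L + 1) c) hmi hnj).trans ?_
    -- The gates of `W` sit on `2 s + 1, 2 s + 2`, so the last pair, ending at the even site `n`,
    -- has index `n / 2 - 1`.
    have e := setEntropy_applyW c.2.2 (phi L c) (m / 2) (n / 2 - 1)
    have h1 : 2 * (m / 2) + 1 = m := Int.two_mul_ediv_two_add_one_of_odd hm
    have h2 : 2 * (n / 2 - 1) + 2 = n := by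
      obtain ⟨t, rfl⟩ := hn
      omega
    rw [h1, h2] at e
    have := ih c _ _ rest
    rw [← e] at this
    rw [cost]
    exact add_le_add le_rfl this

theorem setEntropy_psi_le (h0 : D 0 = 1) : ∀ (L : ℕ)
    (_ : ∀ k < L, D k ≤ D' (k + 1) ^ 2 ∧ D' (k + 1) ≤ D (k + 1))
    (c : Circuit D D' L) (i j : ℤ) (Q : ReductionSequence Row.sigma L i j),
    setEntropy (intervalSites L i j) (psi L c) ≤ Q.cost D D'
  | 0, _, c, i, j, Q => by
    cases Q with
    | nil hd => exact (setEntropy_interval_of_dvd (psi_unit h0 0 c) hd).le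
    | sigmaStep hd => exact absurd (by simp) hd
  | L + 1, h, c, i, j, Q =>
    setEntropy_psi_le_of_phi h0 L h
      (setEntropy_phi_le_of_psi h0 L h (setEntropy_psi_le h0 L fun k hk => h k (by omega))) c i j Q

theorem setEntropy_phi_le (h0 : D 0 = 1) (L : ℕ)
    (h : ∀ k < L + 1, D k ≤ D' (k + 1) ^ 2 ∧ D' (k + 1) ≤ D (k + 1))
    (c : Circuit D D' (L + 1)) (i j : ℤ) (Q : ReductionSequence Row.tau (L + 1) i j) :
    setEntropy (intervalSites (L + 1) i j) (phi L c) ≤ Q.cost D D' :=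
  setEntropy_phi_le_of_psi h0 L h (setEntropy_psi_le h0 L fun k hk => h k (by omega)) c i j Q

/-! ### The lower bound -/

/-- The witnesses take `δ = 1` when `i` is the second site of its pair, and `δ' = 1` when `j` is the
first site of its pair. -/
theorem exists_endpoints (p : ℕ) (i j : ℤ) : ∃ (a b : ℤ) (δ δ' : ℕ), δ ≤ 1 ∧ δ' ≤ 1 ∧
    i = 2 * a + p + δ ∧ j = 2 * b + p + 1 - δ' := by
  refine ⟨(i - p) / 2, (j - p) / 2, ((i - p) % 2).toNat, (1 - (j - p) % 2).toNat, ?_, ?_,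
    ?_, ?_⟩ <;> omega

theorem re_integral_purity_le_one {ι α Ω : Type} [Fintype ι] [DecidableEq ι] [Fintype α]
    [DecidableEq α] [MeasurableSpace Ω] {v : Ω → (ι → α) → ℂ} (A : Finset ι) {μ : Measure Ω}
    [IsProbabilityMeasure μ] (hv : ∀ c, ∑ x, v c x * (starRingEnd ℂ) (v c x) = 1) :
    (∫ c, purity A (v c) ∂μ).re ≤ 1 := by
  refine (Complex.re_le_norm _).trans ((norm_integral_le_of_norm_le_const (C := 1)
    (Filter.Eventually.of_forall fun c => norm_purity_le_one A (hv c))).trans ?_)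
  simp

/-- The bookkeeping of one step: `log d * n` is its cost and cancels the weight, and `log 4` pays
for the number of terms. -/
theorem four_mul_inv_pow_mul_exp {d : ℕ} (hd : 0 < d) (n : ℕ) (s : ℝ) :
    4 * ((d : ℝ)⁻¹ ^ n * Real.exp (-(s - Real.log d * n + Real.log 4))) = Real.exp (-s) := by
  have hd' : (0 : ℝ) < d := by exact_mod_cast hd
  have e : -(s - Real.log d * n + Real.log 4) = -s + n * Real.log d - Real.log 4 := by ring
  rw [e, Real.exp_sub, Real.exp_add, Real.exp_log (by norm_num), Real.exp_nat_mul,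
    Real.exp_log hd', inv_pow]
  field_simp

/-- Keeping or dropping a cut pair moves the endpoint outward or inward by one site, at the same
cost. -/
theorem abs_sub_endpoint {δ x : ℕ} (hδ : δ ≤ 1) (hx : x ∈ Finset.range (δ + 1)) (a : ℤ) (p : ℤ) :
    |2 * (a + x) + p - (2 * a + p + δ)| = δ := by
  have hx' := Finset.mem_range.mp hx
  interval_cases δ
  · have : x = 0 := by omega
    subst this
    simp
  · interval_cases x
    · have : 2 * (a + ((0 : ℕ) : ℤ)) + p - (2 * a + p + ((1 : ℕ) : ℤ)) = -1 := by push_cast; ring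
      rw [this]; rfl
    · have : 2 * (a + ((1 : ℕ) : ℤ)) + p - (2 * a + p + ((1 : ℕ) : ℤ)) = 1 := by push_cast; ring
      rw [this]; rfl

theorem abs_sub_endpoint' {δ y : ℕ} (hδ : δ ≤ 1) (hy : y ∈ Finset.range (δ + 1)) (b : ℤ) (p : ℤ) :
    |2 * (b - y) + 1 + p - (2 * b + p + 1 - δ)| = δ := by
  have e : 2 * (b - y) + 1 + p - (2 * b + p + 1 - δ) = -(2 * (-b + y) + -p - (2 * -b + -p + δ)) := by
    ring
  rw [e, abs_neg, abs_sub_endpoint hδ hy]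

/-- A free lower bound `s` stands in for the minimum over sequences. Prepending the current step to
any sequence for a contributing interval gives a sequence for `[i, j]`, so the induction hypothesis
applies with `s` lowered by the step's cost and raised by `log 4`. -/
theorem re_integral_purity_phi_le_of_psi (h0 : D 0 = 1) (L : ℕ)
    (h : ∀ k < L + 1, D k ≤ D' (k + 1) ^ 2 ∧ D' (k + 1) ≤ D (k + 1))
    (ih : ∀ i j : ℤ, i ≤ j + 1 → j + 1 ≤ i + 2 ^ L → ∀ s : ℝ,
      (∀ Q : ReductionSequence Row.sigma L i j, s ≤ Q.cost D D' - Real.log 4 * Q.height) →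
      (∫ c, purity (intervalSites L i j) (psi L c) ∂circuitMeasure D D' L).re ≤ Real.exp (-s))
    (i j : ℤ) (hij : i ≤ j + 1) (hji : j + 1 ≤ i + 2 ^ (L + 1)) (s : ℝ)
    (hs : ∀ Q : ReductionSequence Row.tau (L + 1) i j,
      s ≤ Q.cost D D' - Real.log 4 * Q.height) :
    (∫ c, purity (intervalSites (L + 1) i j) (phi L c) ∂circuitMeasure D D' (L + 1)).re ≤
      Real.exp (-s) := by
  have hprob := isProbabilityMeasure_circuitMeasure (L + 1) h
  by_cases hd : (2 : ℤ) ^ (L + 1) ∣ j + 1 - i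
  -- The trivial sequence forces `s ≤ 0`, and a purity is at most one.
  · have hs0 := hs (nil hd)
    simp only [cost, height] at hs0
    exact (re_integral_purity_le_one _ (phi_unit h0 L)).trans
      (Real.one_le_exp (by simpa using hs0))
  have hdim := dim_pos' h0 L h
  obtain ⟨a, b, δ, δ', hδ, hδ', rfl, rfl⟩ := exists_endpoints 0 i j
  have hne0 : (2 * b + (0 : ℕ) + 1 - δ' : ℤ) + 1 - (2 * a + (0 : ℕ) + δ) ≠ 0 :=
    fun e => hd (e ▸ dvd_zero _)
  have hneN : (2 * b + (0 : ℕ) + 1 - δ' : ℤ) + 1 - (2 * a + (0 : ℕ) + δ) ≠ 2 ^ (L + 1) :=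
    fun e => hd (e ▸ dvd_rfl)
  rw [integral_purity_phi h0 hdim h]
  simp only [Complex.re_sum, Complex.re_ofReal_mul]
  refine (sum_pairWeight_interval_le hdim hδ hδ' (by omega) (by omega) _
    (Real.exp_pos (-(s - Real.log (D' (L + 1)) * ((δ + δ' : ℕ) : ℝ) + Real.log 4))).le
    fun x hx y hy => ?_).trans (four_mul_inv_pow_mul_exp hdim _ s).le
  have hx' := Finset.mem_range.mp hx
  have hy' := Finset.mem_range.mp hy
  refine ih _ _ ?_ ?_ _ fun Q => ?_
  · omega
  · have : (2 : ℤ) ^ (L + 1) = 2 ^ L * 2 := pow_succ _ _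
    omega
  have ea : 2 * (a + x) / 2 = a + x := by omega
  have eb : (2 * (b - y) + 1 - 1) / 2 = b - y := by omega
  have hm := abs_sub_endpoint hδ hx a ((0 : ℕ) : ℤ)
  have hn := abs_sub_endpoint' hδ' hy b ((0 : ℕ) : ℤ)
  simp only [Nat.cast_zero, add_zero] at hm hn
  -- `tauStep` expects the endpoints in halved form, so `Q` is transported along the equalities `ea`
  -- and `eb` together with its cost and height.
  obtain ⟨Q', hQ'⟩ : ∃ Q' : ReductionSequence Row.sigma L (2 * (a + x) / 2)
      ((2 * (b - y) + 1 - 1) / 2), Q'.cost D D' = Q.cost D D' ∧ Q'.height = Q.height := by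
    rw [ea, eb]
    exact ⟨Q, rfl, rfl⟩
  have hs1 := hs (tauStep hd (2 * (a + x)) (2 * (b - y) + 1) (even_two_mul _) (odd_two_mul_add_one _)
    (by simp only [Nat.cast_zero, add_zero, hm]; omega)
    (by simp only [Nat.cast_zero, add_zero, hn]; omega) Q')
  simp only [cost, height, Nat.cast_zero, add_zero, hm, hn, hQ'.1, hQ'.2] at hs1
  push_cast at hs1 ⊢
  linarith

theorem re_integral_purity_psi_le_of_phi (h0 : D 0 = 1) (L : ℕ)
    (h : ∀ k < L + 1, D k ≤ D' (k + 1) ^ 2 ∧ D' (k + 1) ≤ D (k + 1))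
    (ih : ∀ i j : ℤ, i ≤ j + 1 → j + 1 ≤ i + 2 ^ (L + 1) → ∀ s : ℝ,
      (∀ Q : ReductionSequence Row.tau (L + 1) i j, s ≤ Q.cost D D' - Real.log 4 * Q.height) →
      (∫ c, purity (intervalSites (L + 1) i j) (phi L c) ∂circuitMeasure D D' (L + 1)).re ≤
        Real.exp (-s))
    (i j : ℤ) (hij : i ≤ j + 1) (hji : j + 1 ≤ i + 2 ^ (L + 1)) (s : ℝ)
    (hs : ∀ Q : ReductionSequence Row.sigma (L + 1) i j,
      s ≤ Q.cost D D' - Real.log 4 * Q.height) :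
    (∫ c, purity (intervalSites (L + 1) i j) (psi (L + 1) c) ∂circuitMeasure D D' (L + 1)).re ≤
      Real.exp (-s) := by
  have hprob := isProbabilityMeasure_circuitMeasure (L + 1) h
  by_cases hd : (2 : ℤ) ^ (L + 1) ∣ j + 1 - i
  · have hs0 := hs (nil hd)
    simp only [cost, height] at hs0
    exact (re_integral_purity_le_one _ (psi_unit h0 (L + 1))).trans
      (Real.one_le_exp (by simpa using hs0))
  have hdim := dim_pos h0 (L + 1) h
  obtain ⟨a, b, δ, δ', hδ, hδ', rfl, rfl⟩ := exists_endpoints 1 i j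
  have hne0 : (2 * b + (1 : ℕ) + 1 - δ' : ℤ) + 1 - (2 * a + (1 : ℕ) + δ) ≠ 0 :=
    fun e => hd (e ▸ dvd_zero _)
  have hneN : (2 * b + (1 : ℕ) + 1 - δ' : ℤ) + 1 - (2 * a + (1 : ℕ) + δ) ≠ 2 ^ (L + 1) :=
    fun e => hd (e ▸ dvd_rfl)
  rw [integral_purity_psi_succ h0 hdim h]
  simp only [Complex.re_sum, Complex.re_ofReal_mul]
  refine (sum_pairWeight_interval_le hdim hδ hδ' (by omega) (by omega) _
    (Real.exp_pos (-(s - Real.log (D (L + 1)) * ((δ + δ' : ℕ) : ℝ) + Real.log 4))).le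
    fun x hx y hy => ?_).trans (four_mul_inv_pow_mul_exp hdim _ s).le
  have hx' := Finset.mem_range.mp hx
  have hy' := Finset.mem_range.mp hy
  -- A layer `W` keeps the number of sites, so an interval of its pairs is read back as an interval
  -- of sites of `phi` with odd left and even right end.
  have hpur : ∀ c : Circuit D D' (L + 1),
      purity (intervalSites L (a + x) (b - y)) (phi L c ∘ (pairUp (pairEquiv L 1)).symm) =
      purity (intervalSites (L + 1) (2 * (a + x) + (1 : ℕ)) (2 * (b - y) + 1 + (1 : ℕ)))
        (phi L c) := by
    intro c
    rw [← purity_comp_pairUp_of_mem (pairEquiv L 1) _ (pairEquiv_inl_mem L 1 (a + x) (b - y))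
      (pairEquiv_inr_mem L 1 (a + x) (b - y))]
    congr 1
    ext z
    simp
  simp only [hpur]
  refine ih _ _ ?_ ?_ _ fun Q => ?_
  · omega
  · have : (2 : ℤ) ^ (L + 1) = 2 ^ L * 2 := pow_succ _ _
    omega
  have hm := abs_sub_endpoint hδ hx a ((1 : ℕ) : ℤ)
  have hn := abs_sub_endpoint' hδ' hy b ((1 : ℕ) : ℤ)
  have hs1 := hs (sigmaStep hd (2 * (a + x) + ((1 : ℕ) : ℤ)) _ (odd_two_mul_add_one _)
    ⟨b - y + 1, by push_cast; ring⟩ (by rw [hm]; omega) (by rw [hn]; omega) Q)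
  simp only [cost, height, hm, hn] at hs1
  push_cast at hs1 ⊢
  linarith

theorem re_integral_purity_psi_le (h0 : D 0 = 1) : ∀ (L : ℕ)
    (_ : ∀ k < L, D k ≤ D' (k + 1) ^ 2 ∧ D' (k + 1) ≤ D (k + 1))
    (i j : ℤ) (_ : i ≤ j + 1) (_ : j + 1 ≤ i + 2 ^ L) (s : ℝ)
    (_ : ∀ Q : ReductionSequence Row.sigma L i j, s ≤ Q.cost D D' - Real.log 4 * Q.height),
    (∫ c, purity (intervalSites L i j) (psi L c) ∂circuitMeasure D D' L).re ≤ Real.exp (-s)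
  | 0, h, i, j, _, _, s, hs => by
    have hprob := isProbabilityMeasure_circuitMeasure 0 h
    have hs0 := hs (nil (by simp))
    simp only [cost, height] at hs0
    exact (re_integral_purity_le_one _ (psi_unit h0 0)).trans
      (Real.one_le_exp (by simpa using hs0))
  | L + 1, h, i, j, hij, hji, s, hs =>
    re_integral_purity_psi_le_of_phi h0 L h
      (re_integral_purity_phi_le_of_psi h0 L h
        (re_integral_purity_psi_le h0 L fun k hk => h k (by omega))) i j hij hji s hs

theorem re_integral_purity_phi_le (h0 : D 0 = 1) (L : ℕ)
    (h : ∀ k < L + 1, D k ≤ D' (k + 1) ^ 2 ∧ D' (k + 1) ≤ D (k + 1))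
    (i j : ℤ) (hij : i ≤ j + 1) (hji : j + 1 ≤ i + 2 ^ (L + 1)) (s : ℝ)
    (hs : ∀ Q : ReductionSequence Row.tau (L + 1) i j,
      s ≤ Q.cost D D' - Real.log 4 * Q.height) :
    (∫ c, purity (intervalSites (L + 1) i j) (phi L c) ∂circuitMeasure D D' (L + 1)).re ≤
      Real.exp (-s) :=
  re_integral_purity_phi_le_of_psi h0 L h
    (re_integral_purity_psi_le h0 L fun k hk => h k (by omega)) i j hij hji s hs

end Bounds

end RandomMERA

/-! ### The main theorem -/

theorem mainTheorem4 :
    ∃ C : ℝ, 0 < C ∧ ∀ (D D' : ℕ → ℕ), D 0 = 1 →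
      -- intervals in the MERA state `ψ(L)`
      (∀ L : ℕ, (∀ k < L, D k ≤ D' (k + 1) ^ 2 ∧ D' (k + 1) ≤ D (k + 1)) →
        ∀ i j : ℤ, i ≤ j + 1 → j + 1 ≤ i + 2 ^ L →
          (∃ s : ℝ,
            IsLeast (Set.range fun Q : RandomMERA.ReductionSequence RandomMERA.Row.sigma L i j =>
              Q.cost D D') s ∧
            ∀ c : RandomMERA.Circuit D D' L,
              RandomMERA.intervalEntropy (RandomMERA.psi L c) i j ≤ s) ∧
          (∃ s : ℝ,
            IsLeast (Set.range fun Q : RandomMERA.ReductionSequence RandomMERA.Row.sigma L i j =>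
              Q.cost D D' - C * Q.height) s ∧
            MeasureTheory.Integrable (fun c : RandomMERA.Circuit D D' L =>
              RandomMERA.intervalEntropy (RandomMERA.psi L c) i j)
              (RandomMERA.circuitMeasure D D' L) ∧
            s ≤ ∫ c : RandomMERA.Circuit D D' L,
              RandomMERA.intervalEntropy (RandomMERA.psi L c) i j
                ∂(RandomMERA.circuitMeasure D D' L))) ∧
      -- intervals in the state `φ(L + 1)`, before the last layer of the MERA
      (∀ L : ℕ, (∀ k < L + 1, D k ≤ D' (k + 1) ^ 2 ∧ D' (k + 1) ≤ D (k + 1)) →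
        ∀ i j : ℤ, i ≤ j + 1 → j + 1 ≤ i + 2 ^ (L + 1) →
          (∃ s : ℝ,
            IsLeast (Set.range fun Q : RandomMERA.ReductionSequence RandomMERA.Row.tau (L + 1) i j =>
              Q.cost D D') s ∧
            ∀ c : RandomMERA.Circuit D D' (L + 1),
              RandomMERA.intervalEntropy (RandomMERA.phi L c) i j ≤ s) ∧
          (∃ s : ℝ,
            IsLeast (Set.range fun Q : RandomMERA.ReductionSequence RandomMERA.Row.tau (L + 1) i j =>
              Q.cost D D' - C * Q.height) s ∧
            MeasureTheory.Integrable (fun c : RandomMERA.Circuit D D' (L + 1) =>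
              RandomMERA.intervalEntropy (RandomMERA.phi L c) i j)
              (RandomMERA.circuitMeasure D D' (L + 1)) ∧
            s ≤ ∫ c : RandomMERA.Circuit D D' (L + 1),
              RandomMERA.intervalEntropy (RandomMERA.phi L c) i j
                ∂(RandomMERA.circuitMeasure D D' (L + 1)))) := by
  -- Each averaged layer contributes at most four intervals, hence `log 4` per step.
  refine ⟨Real.log 4, Real.log_pos (by norm_num), fun D D' h0 => ⟨?_, ?_⟩⟩
  · intro L h i j hij hji
    obtain ⟨Q, hQ⟩ := RandomMERA.ReductionSequence.exists_isLeast
      fun Q : RandomMERA.ReductionSequence RandomMERA.Row.sigma L i j => Q.cost D D'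
    obtain ⟨R, hR⟩ := RandomMERA.ReductionSequence.exists_isLeast
      fun Q : RandomMERA.ReductionSequence RandomMERA.Row.sigma L i j =>
        Q.cost D D' - Real.log 4 * Q.height
    have := RandomMERA.isProbabilityMeasure_circuitMeasure L h
    simp only [RandomMERA.intervalEntropy_eq]
    exact ⟨⟨_, hQ, fun c => RandomMERA.setEntropy_psi_le h0 L h c i j Q⟩, _, hR,
      RandomMERA.integrable_setEntropy _ (RandomMERA.measurable_psi L) (RandomMERA.psi_unit h0 L),
      RandomMERA.le_integral_setEntropy _ (RandomMERA.measurable_psi L) (RandomMERA.psi_unit h0 L)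
        (RandomMERA.re_integral_purity_psi_le h0 L h i j hij hji _ fun Q => hR.2 ⟨Q, rfl⟩)⟩
  · intro L h i j hij hji
    obtain ⟨Q, hQ⟩ := RandomMERA.ReductionSequence.exists_isLeast
      fun Q : RandomMERA.ReductionSequence RandomMERA.Row.tau (L + 1) i j => Q.cost D D'
    obtain ⟨R, hR⟩ := RandomMERA.ReductionSequence.exists_isLeast
      fun Q : RandomMERA.ReductionSequence RandomMERA.Row.tau (L + 1) i j =>
        Q.cost D D' - Real.log 4 * Q.height
    have := RandomMERA.isProbabilityMeasure_circuitMeasure (L + 1) h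
    simp only [RandomMERA.intervalEntropy_eq]
    exact ⟨⟨_, hQ, fun c => RandomMERA.setEntropy_phi_le h0 L h c i j Q⟩, _, hR,
      RandomMERA.integrable_setEntropy _ (RandomMERA.measurable_phi L) (RandomMERA.phi_unit h0 L),
      RandomMERA.le_integral_setEntropy _ (RandomMERA.measurable_phi L) (RandomMERA.phi_unit h0 L)
        (RandomMERA.re_integral_purity_phi_le h0 L h i j hij hji _ fun Q => hR.2 ⟨Q, rfl⟩)⟩
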